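/- Let $\mathcal P_1$ be the set of all $h\in L^\infty(0,1)$ that are nonnegative and concave (up to modification on a null set; $h$ is identified with its unique representative that is concave on the open interval $(0,1)$) and satisfy $\int_0^1 h\,dx=1$. For $h\in\mathcal P_1$ let $$\sigma_1(h)=\inf\left\{\frac{\int_0^1 (v')^2\,h\,dx}{\int_0^1 v^2\,dx}\;:\; v\in H^1(0,1)\setminus\{0\},\ \int_0^1 v\,dx=0\right\}.$$ Let $T_0(x)=2(1-x)$ and $T_1(x)=2x$, both of which belong to $\mathcal P_1$. Then the minimum problem $\min_{h\in\mathcal P_1}\sigma_1(h)$ admits $T_0$ and $T_1$ as its unique solutions: an element $h\in\mathcal P_1$ satisfies $\sigma_1(h)\le\sigma_1(k)$ for all $k\in\mathcal P_1$ if and only if $h=T_0$ or $h=T_1$ on $(0,1)$. Moreover, the minimum value is $$\min_{h\in\mathcal P_1}\sigma_1(h)=\sigma_1(T_0)=\sigma_1(T_1)=\frac{(j'_{0,1})^2}{2},$$ where $j'_{0,1}$ is the first positive zero of the derivative of the Bessel function $J_0$ of the first kind of order $0$. -/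

import Mathlib

open MeasureTheory Set

noncomputable section

/-- Lebesgue measure on the open interval `(0,1)`. -/
def vol01 : Measure ℝ := volume.restrict (Ioo (0 : ℝ) 1)

/-- `g` is a weak derivative of `v` on `(0,1)`: integration by parts holds against every smooth
function with compact support in `(0,1)`. -/
def IsWeakDeriv01 (v g : ℝ → ℝ) : Prop :=
  ∀ φ : ℝ → ℝ, ContDiff ℝ ((⊤ : ℕ∞) : WithTop ℕ∞) φ → HasCompactSupport φ →
    tsupport φ ⊆ Ioo 0 1 →
      ∫ x, v x * deriv φ x ∂vol01 = -∫ x, g x * φ x ∂vol01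

/-- `v` belongs to the Sobolev space `H¹(0,1)` and `g` is its weak derivative `v'`
(unique up to null sets). -/
structure IsSobolevH1 (v g : ℝ → ℝ) : Prop where
  memLp : MemLp v 2 vol01
  memLp_deriv : MemLp g 2 vol01
  weakDeriv : IsWeakDeriv01 v g

/-- The class of profiles: bounded, nonnegative, concave functions on `(0,1)`, not identically zero.
Every almost-everywhere class in `L^∞(0,1)` with a concave representative has exactly one
representative that is concave on the open interval; the values of `h` outside `(0,1)` play no
role. -/
structure IsProfile (h : ℝ → ℝ) : Prop where
  memLp_top : MemLp h ⊤ vol01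
  nonneg : ∀ x ∈ Ioo (0 : ℝ) 1, 0 ≤ h x
  concave : ConcaveOn ℝ (Ioo (0 : ℝ) 1) h
  ne_zero : ∃ x ∈ Ioo (0 : ℝ) 1, h x ≠ 0

/-- The profiles with integral one. -/
def unitProfiles : Set (ℝ → ℝ) :=
  {h | IsProfile h ∧ ∫ x, h x ∂vol01 = 1}

/-- The first Sturm-Liouville-Steklov eigenvalue
`σ₁(h) = inf { ∫ (v')² h / ∫ v² : v ∈ H¹(0,1), v ≠ 0, ∫ v = 0 }`. -/
def steklovEigenvalue (h : ℝ → ℝ) : ℝ :=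
  sInf {r : ℝ | ∃ v v' : ℝ → ℝ, IsSobolevH1 v v' ∧ ∫ x, v x ∂vol01 = 0 ∧
    ∫ x, v x ^ 2 ∂vol01 ≠ 0 ∧
    r = (∫ x, v' x ^ 2 * h x ∂vol01) / ∫ x, v x ^ 2 ∂vol01}

/-- The degenerate triangle `T₀(x) = 2(1 - x)`. -/
def triangleZero (x : ℝ) : ℝ := 2 * (1 - x)

/-- The degenerate triangle `T₁(x) = 2x`. -/
def triangleOne (x : ℝ) : ℝ := 2 * x

/-- The Bessel function of the first kind of order zero, as its (everywhere convergent) power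
series. -/
def besselJZero (x : ℝ) : ℝ :=
  ∑' k : ℕ, (-1 : ℝ) ^ k / (k.factorial : ℝ) ^ 2 * (x / 2) ^ (2 * k)

/-- `j` is the first positive zero of the derivative of the Bessel function `J₀`. -/
def IsFirstZeroBesselDeriv (j : ℝ) : Prop :=
  IsLeast {t : ℝ | 0 < t ∧ deriv besselJZero t = 0} j

end

/-! For a fixed test function the energy `∫ v'² h` is linear in `h`, so a lower bound for `σ₁` only
has to be proved for weights that generate the concave functions. Extended by zero, a nonnegative
concave `h` is a limit of nonnegative combinations of tents `G(·,a)`, the Dirichlet Green functions,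
whose mass is `a(1-a)/2`. Write `f_m` for `besselSeries m` and `Y` for the first positive zero of
`f₁`, so that `j'₀,₁ = 2√Y`. The claim becomes that every tent of unit mass has `σ₁ ≥ 2Y`. The
triangles are the limits of such tents as `a → 0, 1`, and an explicit Bessel function shows that
their eigenvalue is at most `2Y`.

For a tent, put `u(x) = ∫₀ˣ V`. The eigenvalue equation `-(k v')' = σ v` turns into `u'' = -σ u /
k`, and `ρ = u'/u` solves a Riccati equation; completing squares with `ρ` gives a Poincaré
inequality with boundary terms (`le_integral_of_riccati`). On either side of the peak the weight is
linear and `ρ` is a quotient of `f₀` and `f₁`. When the two sides are added, mean zero cancels the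
terms in `V(a)`, and what remains is a multiple of `(∫₀ᵃ V)²`. At `τ = Y` its factor is positive by
`besselSeries_addition_pos`.

That positivity is strict, uniformly for peaks in a compact subinterval. A non-affine `h` lies
strictly above some chord, hence carries tents with such peaks, and has `σ₁ > 2Y`. An affine `h`
positive at both ends dominates a positive constant, and the Poincaré constant `8 > 2Y` of the
constant weight gives strictness again. Only the two triangles are left. -/

/-! ### Bessel series and the first zero of `J₀'` -/

/-- The entire function `y ↦ ∑ (-1)ᵏ yᵏ / (k! (k+m)!)`, which equals
`(x/2)⁻ᵐ J_m(x)` at `y = x²/4`. -/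
noncomputable def besselSeries (m : ℕ) (y : ℝ) : ℝ :=
  ∑' k : ℕ, (-1 : ℝ) ^ k / ((k.factorial : ℝ) * ((k + m).factorial : ℝ)) * y ^ k

theorem abs_besselSeries_term_le (m k : ℕ) {y R : ℝ} (hy : |y| ≤ R) :
    ‖(-1 : ℝ) ^ k / ((k.factorial : ℝ) * ((k + m).factorial : ℝ)) * y ^ k‖
      ≤ R ^ k / k.factorial := by
  have h1 : (1 : ℝ) ≤ ((k + m).factorial : ℝ) := by exact_mod_cast Nat.factorial_pos _
  have h2 : (0 : ℝ) < (k.factorial : ℝ) := by exact_mod_cast Nat.factorial_pos _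
  have h3 : |y| ^ k ≤ R ^ k := pow_le_pow_left₀ (abs_nonneg y) hy k
  rw [Real.norm_eq_abs, abs_mul, abs_div, abs_pow, abs_neg, abs_one, one_pow, abs_pow,
    abs_of_pos (by positivity : (0 : ℝ) < (k.factorial : ℝ) * ((k + m).factorial : ℝ)),
    div_mul_eq_mul_div, one_mul]
  have h4 : 0 ≤ |y| ^ k := by positivity
  apply div_le_div₀ (h4.trans h3) h3 h2
  nlinarith

theorem summable_besselSeries (m : ℕ) (y : ℝ) :
    Summable fun k : ℕ =>
      (-1 : ℝ) ^ k / ((k.factorial : ℝ) * ((k + m).factorial : ℝ)) * y ^ k :=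
  Summable.of_norm_bounded (Real.summable_pow_div_factorial |y|)
    fun k => abs_besselSeries_term_le m k le_rfl

theorem besselSeries_deriv_term (m k : ℕ) (y : ℝ) :
    (-1 : ℝ) ^ (k + 1) / (((k + 1).factorial : ℝ) * ((k + 1 + m).factorial : ℝ)) *
      (((k + 1 : ℕ) : ℝ) * y ^ k) =
    -((-1 : ℝ) ^ k / ((k.factorial : ℝ) * ((k + (m + 1)).factorial : ℝ)) * y ^ k) := by
  have h2 : (k.factorial : ℝ) ≠ 0 := by exact_mod_cast Nat.factorial_ne_zero _
  have h3 : ((k + (m + 1)).factorial : ℝ) ≠ 0 := by exact_mod_cast Nat.factorial_ne_zero _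
  have h4 : (k : ℝ) + 1 ≠ 0 := by positivity
  rw [show k + 1 + m = k + (m + 1) by ring, Nat.factorial_succ k]
  push_cast
  field_simp
  ring

theorem hasDerivAt_besselSeries (m : ℕ) (y : ℝ) :
    HasDerivAt (besselSeries m) (-besselSeries (m + 1) y) y := by
  set c : ℕ → ℝ := fun k => (-1 : ℝ) ^ k / ((k.factorial : ℝ) * ((k + m).factorial : ℝ)) with hc
  -- Termwise differentiation on a ball around 0 that contains `y`. The term of index `k + 1`
  -- differentiates to minus the term of index `k` for `m + 1`, so the exponential series of `R`,
  -- shifted by one, dominates.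
  set R : ℝ := |y| + 1 with hR
  set u : ℕ → ℝ := fun k => match k with
    | 0 => 0
    | k + 1 => R ^ k / k.factorial with hu
  have hus : Summable u := by
    rw [← summable_nat_add_iff 1]
    exact Real.summable_pow_div_factorial R
  have hbound : ∀ k z, z ∈ Metric.ball (0 : ℝ) R → ‖c k * ((k : ℝ) * z ^ (k - 1))‖ ≤ u k := by
    intro k z hz
    have hz' : |z| ≤ R := by
      have := Metric.mem_ball.1 hz
      rw [Real.dist_eq, sub_zero] at this
      exact this.le
    cases k with
    | zero => simp [hu]
    | succ k =>
      simp only [hc, hu, Nat.add_sub_cancel]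
      rw [besselSeries_deriv_term, norm_neg]
      exact abs_besselSeries_term_le (m + 1) k hz'
  have hy : y ∈ Metric.ball (0 : ℝ) R := by
    rw [Metric.mem_ball, Real.dist_eq, sub_zero]
    linarith
  have key := hasDerivAt_tsum_of_isPreconnected (g := fun k z => c k * z ^ k) hus
    Metric.isOpen_ball (convex_ball (0 : ℝ) R).isPreconnected
    (fun k z _ => (hasDerivAt_pow k z).const_mul (c k)) hbound hy
    (summable_besselSeries m y) hy
  have hs : Summable fun k : ℕ => c k * ((k : ℝ) * y ^ (k - 1)) :=
    Summable.of_norm_bounded hus fun k => hbound k y hy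
  rw [hs.tsum_eq_zero_add] at key
  refine (show HasDerivAt (besselSeries m) _ y from key).congr_deriv ?_
  simp only [hc, Nat.add_sub_cancel, besselSeries_deriv_term, tsum_neg]
  simp [besselSeries]

theorem continuous_besselSeries (m : ℕ) : Continuous (besselSeries m) :=
  continuous_iff_continuousAt.2 fun y => (hasDerivAt_besselSeries m y).continuousAt

theorem deriv_besselSeries (m : ℕ) : deriv (besselSeries m) = fun y => -besselSeries (m + 1) y :=
  funext fun y => (hasDerivAt_besselSeries m y).deriv

theorem contDiff_besselSeries (m : ℕ) (n : ℕ) : ContDiff ℝ n (besselSeries m) := by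
  induction n generalizing m with
  | zero => exact contDiff_zero.2 (continuous_besselSeries m)
  | succ n ih =>
    rw [Nat.cast_add, Nat.cast_one, contDiff_succ_iff_deriv]
    refine ⟨fun y => (hasDerivAt_besselSeries m y).differentiableAt, by simp, ?_⟩
    rw [deriv_besselSeries]
    exact (ih (m + 1)).neg

/-- The differential equation `y f'' + f' + f = 0` of `f = besselSeries 0`. -/
theorem mul_besselSeries_two (y : ℝ) :
    y * besselSeries 2 y = besselSeries 1 y - besselSeries 0 y := by
  rw [besselSeries, besselSeries, besselSeries,
    ← (summable_besselSeries 1 y).tsum_sub (summable_besselSeries 0 y),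
    ((summable_besselSeries 1 y).sub (summable_besselSeries 0 y)).tsum_eq_zero_add, ← tsum_mul_left]
  simp only [Nat.factorial, pow_zero, zero_add, Nat.cast_one, mul_one, div_one, sub_self]
  congr 1
  ext k
  have h2 : (k.factorial : ℝ) ≠ 0 := by exact_mod_cast Nat.factorial_ne_zero _
  have h4 : (k : ℝ) + 1 ≠ 0 := by positivity
  have h5 : (k : ℝ) + 1 + 1 ≠ 0 := by positivity
  push_cast
  field_simp
  ring

theorem besselJZero_eq (x : ℝ) : besselJZero x = besselSeries 0 (x ^ 2 / 4) := by
  unfold besselJZero besselSeries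
  congr 1
  ext k
  rw [add_zero, pow_mul, div_pow, sq (k.factorial : ℝ)]
  norm_num

theorem deriv_besselJZero (x : ℝ) :
    deriv besselJZero x = -(x / 2 * besselSeries 1 (x ^ 2 / 4)) := by
  have h : besselJZero = fun x => besselSeries 0 (x ^ 2 / 4) := funext besselJZero_eq
  have h1 : HasDerivAt (fun x : ℝ => x ^ 2 / 4) (x / 2) x := by
    refine ((hasDerivAt_pow 2 x).div_const 4).congr_deriv ?_
    push_cast
    ring
  rw [h]
  have := (hasDerivAt_besselSeries 0 (x ^ 2 / 4)).comp x h1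
  rw [show (fun x => besselSeries 0 (x ^ 2 / 4)) = besselSeries 0 ∘ fun x => x ^ 2 / 4 from rfl,
    this.deriv]
  ring

theorem tendsto_besselSeries_partial (m : ℕ) (y : ℝ) :
    Filter.Tendsto (fun n => ∑ k ∈ Finset.range n,
      (-1 : ℝ) ^ k * (y ^ k / ((k.factorial : ℝ) * ((k + m).factorial : ℝ)))) Filter.atTop
      (nhds (besselSeries m y)) := by
  have := (summable_besselSeries m y).hasSum.tendsto_sum_nat
  refine this.congr fun n => Finset.sum_congr rfl fun k _ => ?_
  ring

theorem antitone_besselSeries_term (m : ℕ) {y : ℝ} (hy : y ∈ Icc (0 : ℝ) 1) :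
    Antitone fun k : ℕ => y ^ k / ((k.factorial : ℝ) * ((k + m).factorial : ℝ)) := by
  refine antitone_nat_of_succ_le fun k => ?_
  have h1 : (0 : ℝ) < (k.factorial : ℝ) := by exact_mod_cast Nat.factorial_pos _
  have h2 : (0 : ℝ) < ((k + m).factorial : ℝ) := by exact_mod_cast Nat.factorial_pos _
  have h3 : (k.factorial : ℝ) ≤ ((k + 1).factorial : ℝ) := by
    exact_mod_cast Nat.factorial_le (Nat.le_succ k)
  have h4 : ((k + m).factorial : ℝ) ≤ ((k + 1 + m).factorial : ℝ) := by
    exact_mod_cast Nat.factorial_le (by omega)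
  have h5 : y ^ (k + 1) ≤ y ^ k := pow_le_pow_of_le_one hy.1 hy.2 (Nat.le_succ k)
  exact div_le_div₀ (pow_nonneg hy.1 k) h5 (by positivity) (mul_le_mul h3 h4 h2.le (by positivity))

theorem besselSeries_zero_pos {y : ℝ} (hy : y ∈ Icc (0 : ℝ) 1) : 0 < besselSeries 0 y := by
  -- Four terms of the alternating series: `1 - y + y²/4 - y³/36 = (2-y)²/4 - y³/36`.
  have := (antitone_besselSeries_term 0 hy).alternating_series_le_tendsto
    (tendsto_besselSeries_partial 0 y) 2
  refine lt_of_lt_of_le ?_ this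
  norm_num [Finset.sum_range_succ, Nat.factorial]
  nlinarith [hy.1, hy.2, pow_pos (show (0 : ℝ) < 2 - y by linarith [hy.2]) 2,
    mul_nonneg (sq_nonneg y) (sub_nonneg.2 hy.2)]

theorem besselSeries_one_pos_of_le_one {y : ℝ} (hy : y ∈ Icc (0 : ℝ) 1) :
    0 < besselSeries 1 y := by
  have := (antitone_besselSeries_term 1 hy).alternating_series_le_tendsto
    (tendsto_besselSeries_partial 1 y) 1
  refine lt_of_lt_of_le ?_ this
  norm_num [Finset.sum_range_succ, Nat.factorial]
  linarith [hy.2]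

/-- At `y = 4` the absolute values of the terms begin `1, 2, 4/3, ...` and decrease only from the
second one on. The alternating estimate is therefore applied to `1 - f₁(4)`, whose first four terms
already sum to more than 1. -/
theorem besselSeries_one_four_neg : besselSeries 1 4 < 0 := by
  set f : ℕ → ℝ := fun k => (4 : ℝ) ^ (k + 1) / (((k + 1).factorial : ℝ) * ((k + 2).factorial : ℝ))
    with hf
  have hanti : Antitone f := by
    refine antitone_nat_of_succ_le fun k => ?_
    have h1 : (0 : ℝ) < ((k + 1).factorial : ℝ) := by exact_mod_cast Nat.factorial_pos _
    have h2 : (0 : ℝ) < ((k + 2).factorial : ℝ) := by exact_mod_cast Nat.factorial_pos _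
    simp only [hf]
    rw [show k + 1 + 2 = k + 2 + 1 by ring, show k + 1 + 1 = k + 2 by ring,
      Nat.factorial_succ (k + 2), div_le_div_iff₀ (by push_cast; positivity) (by positivity)]
    have h6 : ((k + 2).factorial : ℝ) = ((k : ℝ) + 1 + 1) * ((k + 1).factorial : ℝ) := by
      rw [Nat.factorial_succ (k + 1)]
      push_cast
      ring
    push_cast
    have h3 : (0 : ℝ) < 4 ^ (k + 1) * (((k + 1).factorial : ℝ) * ((k + 2).factorial : ℝ)) := by
      positivity
    have h4 : (0 : ℝ) ≤ k := k.cast_nonneg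
    rw [show k + 2 = k + 1 + 1 by ring] at h6
    rw [pow_succ (4 : ℝ) (k + 1)]
    have h5 : (4 : ℝ) ≤ ((k : ℝ) + 1 + 1) * ((k : ℝ) + 2 + 1) := by nlinarith
    have h7 := mul_le_mul_of_nonneg_left h5 h3.le
    calc 4 ^ (k + 1) * 4 * (((k + 1).factorial : ℝ) * ((k + 2).factorial : ℝ))
        = 4 ^ (k + 1) * (((k + 1).factorial : ℝ) * ((k + 2).factorial : ℝ)) * 4 := by ring
      _ ≤ _ := h7
      _ = 4 ^ (k + 1) * ((((k : ℝ) + 2 + 1) * ((k + 2).factorial : ℝ)) *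
          (((k : ℝ) + 1 + 1) * ((k + 1).factorial : ℝ))) := by ring
      _ = _ := by rw [← h6]; ring
  have hsum := summable_besselSeries 1 4
  have hlim : Filter.Tendsto (fun n => ∑ k ∈ Finset.range n, (-1 : ℝ) ^ k * f k) Filter.atTop
      (nhds (1 - besselSeries 1 4)) := by
    have h1 := ((summable_nat_add_iff 1).2 hsum).hasSum.tendsto_sum_nat.neg
    convert h1 using 2
    · rw [← Finset.sum_neg_distrib]
      refine Finset.sum_congr rfl fun k _ => ?_
      simp only [hf]
      rw [show k + 1 + 1 = k + 2 by ring]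
      ring
    · rw [besselSeries, hsum.tsum_eq_zero_add]
      norm_num
  have := hanti.alternating_series_le_tendsto hlim 2
  norm_num [Finset.sum_range_succ, Nat.factorial, hf] at this
  linarith

/-- The bound `Y < 4` is used twice: it gives `√Y < 2` in the addition inequality, and `2Y < 8` in
the comparison with the constant weight. -/
theorem exists_first_zero_besselSeries_one :
    ∃ Y : ℝ, 1 < Y ∧ Y < 4 ∧ besselSeries 1 Y = 0 ∧ ∀ y ∈ Ico 0 Y, 0 < besselSeries 1 y := by
  set S : Set ℝ := Icc 1 4 ∩ besselSeries 1 ⁻¹' {0} with hS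
  have hcont := continuous_besselSeries 1
  have hne : S.Nonempty := by
    obtain ⟨z, hz, hz0⟩ := intermediate_value_Icc' (by norm_num : (1 : ℝ) ≤ 4)
      hcont.continuousOn (show (0 : ℝ) ∈ Icc (besselSeries 1 4) (besselSeries 1 1) from
        ⟨besselSeries_one_four_neg.le, (besselSeries_one_pos_of_le_one ⟨by norm_num, le_rfl⟩).le⟩)
    exact ⟨z, hz, hz0⟩
  have hcomp : IsCompact S := isCompact_Icc.inter_right (isClosed_singleton.preimage hcont)
  obtain ⟨Y, ⟨hY, hY0⟩, hmin⟩ := hcomp.exists_isLeast hne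
  have hY0 : besselSeries 1 Y = 0 := hY0
  have h1 := besselSeries_one_pos_of_le_one (y := 1) ⟨by norm_num, le_rfl⟩
  have hY1 : 1 < Y := lt_of_le_of_ne hY.1 (by rintro rfl; exact h1.ne' hY0)
  have hY4 : Y < 4 := lt_of_le_of_ne hY.2 (by rintro rfl; exact besselSeries_one_four_neg.ne hY0)
  refine ⟨Y, hY1, hY4, hY0, fun y hy => ?_⟩
  by_contra! hneg
  have hy1 : 1 < y := by
    by_contra! h
    exact (besselSeries_one_pos_of_le_one ⟨hy.1, h⟩).not_ge hneg
  obtain ⟨z, hz, hz0⟩ := intermediate_value_Icc' hy1.le hcont.continuousOn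
    (show (0 : ℝ) ∈ Icc (besselSeries 1 y) (besselSeries 1 1) from ⟨hneg, h1.le⟩)
  have := hmin ⟨⟨hz.1, by linarith [hz.2, hy.2]⟩, hz0⟩
  linarith [hz.2, hy.2]

/-- The first positive zero of `J₀'` in terms of the first zero of `besselSeries 1`. -/
theorem isFirstZeroBesselDeriv_of_first_zero {Y : ℝ} (hY : 0 < Y) (hY0 : besselSeries 1 Y = 0)
    (hpos : ∀ y ∈ Ico 0 Y, 0 < besselSeries 1 y) : IsFirstZeroBesselDeriv (2 * √Y) := by
  have hs : 0 < √Y := Real.sqrt_pos.2 hY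
  refine ⟨⟨by positivity, ?_⟩, fun t ht => ?_⟩
  · rw [deriv_besselJZero, mul_pow, Real.sq_sqrt hY.le, show (2 : ℝ) ^ 2 * Y / 4 = Y by ring, hY0]
    simp
  · obtain ⟨ht0, ht⟩ := ht
    by_contra! hlt
    rw [deriv_besselJZero, neg_eq_zero] at ht
    have hlt' : t ^ 2 / 4 < Y := by
      have := Real.sq_sqrt hY.le
      nlinarith
    have := hpos (t ^ 2 / 4) ⟨by positivity, hlt'⟩
    exact (mul_pos (half_pos ht0) this).ne' ht

/-! ### The addition inequality -/

/-- An addition inequality for Bessel functions: with `θ` half the first positive zero of `J₁`,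
`J₀(2p) J₁(2q) + J₀(2q) J₁(2p) > 0` for positive `p`, `q` with `p + q = θ`. -/
theorem besselSeries_addition_pos {Y p q : ℝ} (hY4 : Y < 4) (hY0 : besselSeries 1 Y = 0)
    (hpos : ∀ y ∈ Ico 0 Y, 0 < besselSeries 1 y) (hp : 0 < p) (hq : 0 < q)
    (hpq : (p + q) ^ 2 = Y) :
    0 < besselSeries 0 (p ^ 2) * (q * besselSeries 1 (q ^ 2)) +
      besselSeries 0 (q ^ 2) * (p * besselSeries 1 (p ^ 2)) := by
  wlog hle : q ≤ p generalizing p q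
  · have := this hq hp (by rw [add_comm]; exact hpq) (le_of_not_ge hle)
    linarith
  set θ := p + q with hθ
  have hθ2 : θ < 2 := by nlinarith
  -- Since `q ≤ θ/2 < 1`, the interval `[0, q]` lies where `f₀(x²)` is known to be positive. Only
  -- the sign of `f₀(p²)` is in doubt, and a nonnegative value makes the claim immediate.
  have hA : ∀ x ∈ Icc 0 q, 0 < besselSeries 0 (x ^ 2) := fun x hx =>
    besselSeries_zero_pos ⟨sq_nonneg x, by nlinarith [hx.1, hx.2]⟩
  have hB : ∀ x ∈ Ico 0 θ, 0 < besselSeries 1 (x ^ 2) := fun x hx =>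
    hpos _ ⟨sq_nonneg x, by nlinarith [hx.1, hx.2]⟩
  have hdA : ∀ x, HasDerivAt (fun x => besselSeries 0 (x ^ 2)) (-(2 * (x * besselSeries 1 (x ^ 2))))
      x := by
    intro x
    refine ((hasDerivAt_besselSeries 0 (x ^ 2)).comp x (hasDerivAt_pow 2 x)).congr_deriv ?_
    push_cast
    ring
  have hdB : ∀ x, HasDerivAt (fun x => x * besselSeries 1 (x ^ 2))
      (2 * besselSeries 0 (x ^ 2) - besselSeries 1 (x ^ 2)) x := by
    intro x
    have h1 := (hasDerivAt_besselSeries 1 (x ^ 2)).comp x (hasDerivAt_pow 2 x)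
    refine ((hasDerivAt_id' x).mul h1).congr_deriv ?_
    have h2 := mul_besselSeries_two (x ^ 2)
    simp only [Function.comp]
    push_cast
    linear_combination (-2) * h2
  have hpA := hA q ⟨hq.le, le_rfl⟩
  have hpB := hB p ⟨hp.le, by linarith⟩
  have hqB := hB q ⟨hq.le, by linarith⟩
  rcases le_or_gt 0 (besselSeries 0 (p ^ 2)) with h0 | h0
  · have := mul_nonneg h0 (mul_pos hq hqB).le
    have := mul_pos hpA (mul_pos hp hpB)
    linarith
  have hrefl : ∀ x : ℝ, HasDerivAt (fun x => θ - x) (-1) x := fun x => by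
    simpa using (hasDerivAt_id x).const_sub θ
  have hC : ∀ x ∈ Icc 0 q, besselSeries 0 ((θ - x) ^ 2) < 0 := by
    intro x hx
    have hanti : AntitoneOn (fun x => besselSeries 0 (x ^ 2)) (Icc p θ) := by
      refine antitoneOn_of_deriv_nonpos (convex_Icc _ _)
        (fun x _ => (hdA x).continuousAt.continuousWithinAt)
        (fun x _ => (hdA x).differentiableAt.differentiableWithinAt) fun x hx => ?_
      rw [interior_Icc] at hx
      rw [(hdA x).deriv]
      have := mul_pos (hp.trans hx.1) (hB x ⟨(hp.trans hx.1).le, hx.2⟩)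
      linarith
    have := hanti ⟨le_rfl, by linarith⟩
      (show θ - x ∈ Icc p θ from ⟨by linarith [hx.2], by linarith [hx.1]⟩) (by linarith [hx.2])
    exact lt_of_le_of_lt this h0
  -- `E(q)` is the quantity in question, and `E(0) = 0` because `θ² = Y`. In `E'` the terms with
  -- coefficient 2 cancel, and the signs of `f₀` on `[0, q]` and on `[p, θ]` make the remainder
  -- positive.
  set E : ℝ → ℝ := fun x => besselSeries 0 (x ^ 2) * ((θ - x) * besselSeries 1 ((θ - x) ^ 2)) +
    x * besselSeries 1 (x ^ 2) * besselSeries 0 ((θ - x) ^ 2) with hE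
  have hdE : ∀ x, HasDerivAt E
      (besselSeries 0 (x ^ 2) * besselSeries 1 ((θ - x) ^ 2) -
        besselSeries 1 (x ^ 2) * besselSeries 0 ((θ - x) ^ 2)) x := by
    intro x
    have h1 := (hdA (θ - x)).comp x (hrefl x)
    have h2 := (hdB (θ - x)).comp x (hrefl x)
    refine (((hdA x).mul h2).add ((hdB x).mul h1)).congr_deriv ?_
    simp only [Function.comp]
    ring
  have hmono : StrictMonoOn E (Icc 0 q) := by
    refine strictMonoOn_of_deriv_pos (convex_Icc _ _)
      (fun x _ => (hdE x).continuousAt.continuousWithinAt) fun x hx => ?_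
    rw [interior_Icc] at hx
    have hx' : x ∈ Icc 0 q := ⟨hx.1.le, hx.2.le⟩
    rw [(hdE x).deriv]
    have h1 := mul_pos (hA x hx') (hB (θ - x) ⟨by linarith [hx.2], by linarith [hx.1]⟩)
    have h2 := mul_neg_of_pos_of_neg (hB x ⟨hx.1.le, by linarith [hx.2]⟩) (hC x hx')
    linarith
  have := hmono ⟨le_rfl, hq.le⟩ ⟨hq.le, le_rfl⟩ hq
  simp only [hE] at this
  rw [sub_zero, hpq, hY0, show θ - q = p by rw [hθ]; ring] at this
  linarith

/-! ### Sobolev functions on the interval as primitives -/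

theorem integral_vol01 (f : ℝ → ℝ) : ∫ x, f x ∂vol01 = ∫ x in (0 : ℝ)..1, f x := by
  rw [vol01, intervalIntegral.integral_of_le zero_le_one, integral_Ioc_eq_integral_Ioo]

theorem integral_vol01_of_tsupport_subset {f : ℝ → ℝ} (hf : tsupport f ⊆ Ioo 0 1) :
    ∫ x, f x ∂vol01 = ∫ x, f x := by
  rw [vol01]
  exact setIntegral_eq_integral_of_forall_compl_eq_zero fun x hx =>
    image_eq_zero_of_notMem_tsupport fun h => hx (hf h)

instance isFiniteMeasure_vol01 : IsFiniteMeasure vol01 := by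
  unfold vol01
  infer_instance

/-- A smooth function with compact support in `(0,1)` and vanishing integral has a primitive of the
same kind. -/
theorem exists_testFunction_primitive {χ : ℝ → ℝ}
    (hχ : ContDiff ℝ ((⊤ : ℕ∞) : WithTop ℕ∞) χ) (hc : HasCompactSupport χ)
    (hs : tsupport χ ⊆ Ioo 0 1) (h0 : ∫ x, χ x = 0) :
    ∃ φ : ℝ → ℝ, ContDiff ℝ ((⊤ : ℕ∞) : WithTop ℕ∞) φ ∧ HasCompactSupport φ ∧
      tsupport φ ⊆ Ioo 0 1 ∧ deriv φ = χ := by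
  -- The point `1/2` is adjoined so that the extreme points exist even when `χ = 0`.
  have hK : IsCompact (tsupport χ ∪ {1 / 2}) := hc.isCompact.union isCompact_singleton
  have hKs : tsupport χ ∪ {1 / 2} ⊆ Ioo 0 1 :=
    union_subset hs (singleton_subset_iff.2 ⟨by norm_num, by norm_num⟩)
  have hne : (tsupport χ ∪ {1 / 2}).Nonempty := ⟨1 / 2, Or.inr rfl⟩
  obtain ⟨α, hα, hαl⟩ := hK.exists_isLeast hne
  obtain ⟨β, hβ, hβg⟩ := hK.exists_isGreatest hne
  have hα0 := hKs hα
  have hβ0 := hKs hβ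
  have hzero : ∀ x, x < α ∨ β < x → χ x = 0 := fun x hx =>
    image_eq_zero_of_notMem_tsupport fun h => by
      have h1 := hαl (Or.inl h)
      have h2 := hβg (Or.inl h)
      rcases hx with hx | hx <;> linarith
  have hcont : Continuous χ := hχ.continuous
  have hd : ∀ x, HasDerivAt (fun x => ∫ t in (0 : ℝ)..x, χ t) (χ x) x := fun x =>
    intervalIntegral.integral_hasDerivAt_right (hcont.intervalIntegrable _ _)
      (hcont.stronglyMeasurableAtFilter _ _) hcont.continuousAt
  have hderiv : deriv (fun x => ∫ t in (0 : ℝ)..x, χ t) = χ := funext fun x => (hd x).deriv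
  have hsupp : Function.support (fun x => ∫ t in (0 : ℝ)..x, χ t) ⊆ Icc (α / 2) ((1 + β) / 2) := by
    intro x hx
    by_contra hx'
    apply hx
    rw [mem_Icc, not_and_or, not_le, not_le] at hx'
    rcases hx' with hx' | hx'
    · refine intervalIntegral.integral_zero_ae ?_
      refine Filter.Eventually.of_forall fun t ht => hzero t (Or.inl ?_)
      have := (mem_uIoc.1 ht)
      rcases this with h | h <;> linarith [h.1, h.2, hα0.1]
    · change ∫ t in (0 : ℝ)..x, χ t = 0
      rw [intervalIntegral.integral_eq_integral_of_support_subset, h0]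
      intro t ht
      by_contra htn
      refine ht (hzero t ?_)
      rw [mem_Ioc, not_and_or, not_lt, not_le] at htn
      rcases htn with h | h
      · exact Or.inl (by linarith [hα0.1])
      · exact Or.inr (by linarith [hβ0.2])
  have htsupp := closure_minimal hsupp isClosed_Icc
  refine ⟨_, contDiff_infty_iff_deriv.2 ⟨fun x => (hd x).differentiableAt, ?_⟩,
    HasCompactSupport.intro isCompact_Icc (K := Icc (α / 2) ((1 + β) / 2)) fun x hx => ?_,
    htsupp.trans fun x hx => ⟨by linarith [hx.1, hα0.1], by linarith [hx.2, hβ0.2]⟩, hderiv⟩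
  · rw [hderiv]
    exact hχ
  · by_contra h
    exact hx (hsupp h)

/-- The lemma of du Bois-Reymond: a function on `(0,1)` with vanishing weak derivative is
constant. -/
theorem ae_eq_const_of_integral_mul_deriv_eq_zero {d : ℝ → ℝ} (hd : Integrable d vol01)
    (h : ∀ φ : ℝ → ℝ, ContDiff ℝ ((⊤ : ℕ∞) : WithTop ℕ∞) φ → HasCompactSupport φ →
      tsupport φ ⊆ Ioo 0 1 → ∫ x, d x * deriv φ x ∂vol01 = 0) :
    ∃ c : ℝ, d =ᵐ[vol01] fun _ => c := by
  let b : ContDiffBump (1 / 2 : ℝ) := ⟨1 / 8, 1 / 4, by norm_num, by norm_num⟩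
  set η : ℝ → ℝ := b.normed volume with hη
  have hηs : ContDiff ℝ ((⊤ : ℕ∞) : WithTop ℕ∞) η := b.contDiff_normed
  have hηc : HasCompactSupport η := b.hasCompactSupport_normed
  have hηt : tsupport η ⊆ Ioo 0 1 := by
    rw [hη, b.tsupport_normed_eq, Real.closedBall_eq_Icc]
    intro x hx
    norm_num [b] at hx
    exact ⟨by linarith [hx.1], by linarith [hx.2]⟩
  have hη1 : ∫ x, η x = 1 := b.integral_normed
  have hmul : ∀ ψ : ℝ → ℝ, Continuous ψ → HasCompactSupport ψ →
      Integrable (fun x => d x * ψ x) vol01 := by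
    intro ψ hψ hψc
    obtain ⟨C, hC⟩ := hψ.bounded_above_of_compact_support hψc
    exact hd.mul_bdd (c := C) hψ.aestronglyMeasurable (Filter.Eventually.of_forall hC)
  refine ⟨∫ x, d x * η x ∂vol01, ?_⟩
  set c := ∫ x, d x * η x ∂vol01 with hc
  have hloc : LocallyIntegrableOn (fun x => d x - c) (Ioo 0 1) := by
    refine IntegrableOn.locallyIntegrableOn ?_
    exact hd.sub (integrable_const c)
  have key := isOpen_Ioo.ae_eq_zero_of_integral_contDiff_smul_eq_zero hloc
    fun ψ hψ hψc hψt => ?_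
  · rw [vol01, Filter.EventuallyEq, ae_restrict_iff' measurableSet_Ioo]
    filter_upwards [key] with x hx hx'
    exact sub_eq_zero.1 (hx hx')
  · have hψi : Integrable ψ := hψ.continuous.integrable_of_hasCompactSupport hψc
    have hηi : Integrable η := hηs.continuous.integrable_of_hasCompactSupport hηc
    -- Subtracting `(∫ψ) η` makes the integral vanish, so the difference is the derivative of a test
    -- function. The hypothesis then reads `∫ d ψ = c ∫ ψ`.
    obtain ⟨φ, hφ, hφc, hφt, hφd⟩ := exists_testFunction_primitive
      (χ := fun x => ψ x - (∫ y, ψ y) * η x) (hψ.sub (contDiff_const.mul hηs))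
      (hψc.sub (hηc.mul_left))
      ((tsupport_sub _ _).trans (union_subset hψt ((tsupport_mul_subset_right).trans hηt)))
      (by rw [integral_sub hψi (hηi.const_mul _), integral_const_mul, hη1, mul_one, sub_self])
    have h1 := h φ hφ hφc hφt
    rw [hφd] at h1
    have h2 : ∫ x, d x * (ψ x - (∫ y, ψ y) * η x) ∂vol01 =
        ∫ x, d x * ψ x ∂vol01 - (∫ y, ψ y) * c := by
      rw [hc, ← integral_const_mul, ← integral_sub (hmul ψ hψ.continuous hψc)
        ((hmul η hηs.continuous hηc).const_mul _)]
      congr 1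
      ext x
      ring
    have h3 : ∫ x, ψ x • (d x - c) = ∫ x, ψ x • (d x - c) ∂vol01 :=
      (integral_vol01_of_tsupport_subset ((tsupport_smul_subset_left _ _).trans hψt)).symm
    rw [h3]
    have h4 : ∫ x, ψ x • (d x - c) ∂vol01 = ∫ x, d x * ψ x ∂vol01 - c * ∫ x, ψ x ∂vol01 := by
      rw [← integral_const_mul, ← integral_sub (hmul ψ hψ.continuous hψc)]
      · congr 1
        ext x
        simp only [smul_eq_mul]
        ring
      · exact (hψi.restrict (s := Ioo 0 1)).const_mul c
    rw [h4, integral_vol01_of_tsupport_subset hψt]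
    rw [h2] at h1
    linarith

/-- `V` is a primitive of the integrable and square integrable function `g`. -/
structure IsSobolevPrimitive (V g : ℝ → ℝ) : Prop where
  integrable : Integrable g
  integrable_sq : Integrable fun x => g x ^ 2
  eq_add_integral : ∀ x, V x = V 0 + ∫ t in (0 : ℝ)..x, g t

namespace IsSobolevPrimitive

variable {V g : ℝ → ℝ}

theorem ae_hasDerivAt (h : IsSobolevPrimitive V g) : ∀ᵐ x, HasDerivAt V (g x) x := by
  filter_upwards [LocallyIntegrable.ae_hasDerivAt_integral h.integrable.locallyIntegrable] with x hx
  rw [funext h.eq_add_integral]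
  exact (hx 0).const_add _

theorem absolutelyContinuousOnInterval (h : IsSobolevPrimitive V g) (a b : ℝ) :
    AbsolutelyContinuousOnInterval V a b := by
  have h1 : AbsolutelyContinuousOnInterval (fun x => ∫ t in a..x, g t) a b :=
    (h.integrable.intervalIntegrable).absolutelyContinuousOnInterval_intervalIntegral left_mem_uIcc
  have h2 : AbsolutelyContinuousOnInterval (fun _ : ℝ => V a) a b :=
    contDiffOn_const.absolutelyContinuousOnInterval
  have h3 : V = (fun _ : ℝ => V a) + fun x => ∫ t in a..x, g t := by
    ext x
    rw [Pi.add_apply, h.eq_add_integral x, h.eq_add_integral a, add_assoc,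
      intervalIntegral.integral_add_adjacent_intervals h.integrable.intervalIntegrable
        h.integrable.intervalIntegrable]
  rw [h3]
  exact h2.add h1

theorem continuous (h : IsSobolevPrimitive V g) : Continuous V := by
  rw [funext h.eq_add_integral]
  exact continuous_const.add (intervalIntegral.continuous_primitive
    (fun _ _ => h.integrable.intervalIntegrable) 0)

theorem comp_one_sub (h : IsSobolevPrimitive V g) :
    IsSobolevPrimitive (fun x => V (1 - x)) (fun x => -g (1 - x)) where
  integrable := (h.integrable.comp_sub_left 1).neg
  integrable_sq := by
    simp only [neg_sq]
    exact h.integrable_sq.comp_sub_left 1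
  eq_add_integral x := by
    rw [intervalIntegral.integral_neg, intervalIntegral.integral_comp_sub_left, sub_zero,
      h.eq_add_integral (1 - x), h.eq_add_integral 1,
      ← intervalIntegral.integral_add_adjacent_intervals (b := 1 - x) (c := (1 : ℝ))
        h.integrable.intervalIntegrable h.integrable.intervalIntegrable]
    ring

end IsSobolevPrimitive

/-- Extend `v'` by zero and integrate: the primitive has the same weak derivative as `v`, so by du
Bois-Reymond the two differ by a constant. From here on one may integrate absolutely continuous
functions by parts. -/
theorem IsSobolevH1.exists_isSobolevPrimitive {v v' : ℝ → ℝ} (hv : IsSobolevH1 v v') :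
    ∃ V g : ℝ → ℝ, IsSobolevPrimitive V g ∧ v =ᵐ[vol01] V ∧ v' =ᵐ[vol01] g := by
  set g : ℝ → ℝ := (Ioo (0 : ℝ) 1).indicator v' with hg
  have hv'1 : Integrable v' vol01 := hv.memLp_deriv.integrable one_le_two
  have hv1 : Integrable v vol01 := hv.memLp.integrable one_le_two
  have hgi : Integrable g := (integrable_indicator_iff measurableSet_Ioo).2 hv'1
  have hg2 : Integrable fun x => g x ^ 2 := by
    have : (fun x => g x ^ 2) = (Ioo (0 : ℝ) 1).indicator fun x => v' x ^ 2 := by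
      ext x
      by_cases hx : x ∈ Ioo (0 : ℝ) 1 <;> simp [hg, hx]
    rw [this]
    exact (integrable_indicator_iff measurableSet_Ioo).2 hv.memLp_deriv.integrable_sq
  have hgv : v' =ᵐ[vol01] g := by
    rw [vol01, Filter.EventuallyEq, ae_restrict_iff' measurableSet_Ioo]
    exact Filter.Eventually.of_forall fun x hx => by simp [hg, hx]
  set W : ℝ → ℝ := fun x => ∫ t in (0 : ℝ)..x, g t with hW
  have hWp : IsSobolevPrimitive W g := ⟨hgi, hg2, fun x => by simp [hW]⟩
  have hWi : Integrable W vol01 :=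
    (hWp.continuous.integrableOn_Icc (a := 0) (b := 1)).mono_set Ioo_subset_Icc_self
  obtain ⟨c, hc⟩ := ae_eq_const_of_integral_mul_deriv_eq_zero (hv1.sub hWi)
    fun φ hφ hφc hφt => by
    have hbd : ∀ ψ : ℝ → ℝ, Continuous ψ → HasCompactSupport ψ → ∀ f : ℝ → ℝ,
        Integrable f vol01 → Integrable (fun x => f x * ψ x) vol01 := by
      intro ψ hψ hψc f hf
      obtain ⟨C, hC⟩ := hψ.bounded_above_of_compact_support hψc
      exact hf.mul_bdd (c := C) hψ.aestronglyMeasurable (Filter.Eventually.of_forall hC)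
    have hφ' : Continuous (deriv φ) := hφ.continuous_deriv (by simp)
    have h1 := hv.weakDeriv φ hφ hφc hφt
    have hφ0 : φ 0 = 0 := image_eq_zero_of_notMem_tsupport fun h => by simpa using hφt h
    have hφ1 : φ 1 = 0 := image_eq_zero_of_notMem_tsupport fun h => by simpa using hφt h
    have h2 := (hWp.absolutelyContinuousOnInterval 0 1).integral_mul_deriv_eq_deriv_mul
      ((hφ.of_le (by simp)).contDiffOn.absolutelyContinuousOnInterval (f := φ))
    rw [hφ0, hφ1, mul_zero, mul_zero, sub_zero, zero_sub, ← integral_vol01, ← integral_vol01] at h2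
    have h3 : ∫ x, deriv W x * φ x ∂vol01 = ∫ x, v' x * φ x ∂vol01 := by
      refine integral_congr_ae ?_
      filter_upwards [ae_restrict_of_ae hWp.ae_hasDerivAt, hgv] with x hx hx'
      rw [hx.deriv, hx']
    simp only [Pi.sub_apply, sub_mul]
    rw [integral_sub (hbd _ hφ' hφc.deriv _ hv1) (hbd _ hφ' hφc.deriv _ hWi), h1, h2, h3, sub_self]
  refine ⟨fun x => c + W x, g, ⟨hgi, hg2, fun x => by simp [hW]⟩, ?_, hgv⟩
  filter_upwards [hc] with x hx
  rw [← hx]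
  simp

/-- A continuously differentiable function belongs to `H¹(0,1)`. -/
theorem isSobolevH1_of_hasDerivAt {v v' : ℝ → ℝ} (hv : ∀ x, HasDerivAt v (v' x) x)
    (hv' : Continuous v') : IsSobolevH1 v v' := by
  have hb : ∀ f : ℝ → ℝ, Continuous f → MemLp f 2 vol01 := by
    intro f hf
    obtain ⟨C, hC⟩ := isCompact_Icc.exists_bound_of_continuousOn (s := Icc (0 : ℝ) 1)
      hf.continuousOn
    refine MemLp.of_bound hf.aestronglyMeasurable C ?_
    rw [vol01, ae_restrict_iff' measurableSet_Ioo]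
    exact Filter.Eventually.of_forall fun x hx => hC x (Ioo_subset_Icc_self hx)
  have hvc : Continuous v := continuous_iff_continuousAt.2 fun x => (hv x).continuousAt
  refine ⟨hb v hvc, hb v' hv', fun φ hφ hφc hφt => ?_⟩
  have hφ0 : φ 0 = 0 := image_eq_zero_of_notMem_tsupport fun h => by simpa using hφt h
  have hφ1 : φ 1 = 0 := image_eq_zero_of_notMem_tsupport fun h => by simpa using hφt h
  rw [integral_vol01, integral_vol01, intervalIntegral.integral_mul_deriv_eq_deriv_mul
    (fun x _ => hv x) (fun x _ => ((hφ.differentiable (by simp)) x).hasDerivAt)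
    (hv'.intervalIntegrable _ _) ((hφ.continuous_deriv (by simp)).intervalIntegrable _ _),
    hφ0, hφ1]
  ring

/-! ### Poincaré inequalities from Riccati supersolutions -/

namespace IsSobolevPrimitive

variable {V g : ℝ → ℝ}

theorem hasDerivAt_integral (h : IsSobolevPrimitive V g) (x : ℝ) :
    HasDerivAt (fun x => ∫ t in (0 : ℝ)..x, V t) (V x) x :=
  intervalIntegral.integral_hasDerivAt_right (h.continuous.intervalIntegrable _ _)
    (h.continuous.stronglyMeasurableAtFilter _ _) h.continuous.continuousAt

theorem intervalIntegrable_sq_mul (h : IsSobolevPrimitive V g) {k : ℝ → ℝ} (hk : Continuous k)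
    (a b : ℝ) : IntervalIntegrable (fun x => g x ^ 2 * k x) volume a b :=
  h.integrable_sq.intervalIntegrable.mul_continuousOn hk.continuousOn

/-- A weighted Poincaré inequality with boundary terms on `(0,ℓ)`, for the weight `k`, derived from
a supersolution `ρ` of the Riccati equation `ρ' = -σ/k - ρ²`. -/
theorem le_integral_of_riccati (h : IsSobolevPrimitive V g) {k ρ ρ' : ℝ → ℝ} {σ ℓ r : ℝ}
    (hσ : 0 < σ) (hℓ : 0 < ℓ) (hk : Continuous k) (hkpos : ∀ x ∈ Ioc 0 ℓ, 0 < k x)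
    (hρ : ∀ x ∈ Ioc 0 ℓ, HasDerivAt ρ (ρ' x) x) (hρc : ContDiffOn ℝ 1 ρ (Ioc 0 ℓ))
    (hr : Filter.Tendsto (fun x => x * ρ x) (nhdsWithin 0 (Ioi 0)) (nhds r))
    (hle : ∀ x ∈ Ioc 0 ℓ, ρ' x ≤ -(σ / k x) - ρ x ^ 2) :
    σ * (∫ x in (0 : ℝ)..ℓ, V x ^ 2) - 2 * σ * (∫ x in (0 : ℝ)..ℓ, V x) * V ℓ +
      σ * (∫ x in (0 : ℝ)..ℓ, V x) ^ 2 * ρ ℓ ≤ ∫ x in (0 : ℝ)..ℓ, g x ^ 2 * k x := by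
  set u : ℝ → ℝ := fun x => ∫ t in (0 : ℝ)..x, V t with hu
  have hdu : ∀ x, HasDerivAt u (V x) x := h.hasDerivAt_integral
  have hu1 : ContDiff ℝ 1 u := by
    rw [contDiff_one_iff_deriv]
    refine ⟨fun x => (hdu x).differentiableAt, ?_⟩
    rw [show deriv u = V from funext fun x => (hdu x).deriv]
    exact h.continuous
  have hVsq : ∀ a b, IntervalIntegrable (fun x => σ * V x ^ 2) volume a b := fun a b =>
    (continuous_const.mul (h.continuous.pow 2)).intervalIntegrable a b
  have hgk := h.intervalIntegrable_sq_mul hk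
  set q : ℝ → ℝ := fun x => g x ^ 2 * k x - σ * V x ^ 2 with hq
  have hqi : ∀ a b, IntervalIntegrable q volume a b := fun a b => (hgk a b).sub (hVsq a b)
  -- The boundary terms are `F(ℓ)`, and the aim is `F' ≤ g² k - σ V²`. Since `ρ` may blow up at 0,
  -- integration starts at `α > 0` and `α → 0` follows.
  set F : ℝ → ℝ := fun x => (-2 * σ) * (u x * V x) + σ * (u x * u x * ρ x) with hF
  have hstep : ∀ α ∈ Ioo 0 ℓ, F ℓ - F α ≤ ∫ x in α..ℓ, q x := by
    intro α hα
    have huIcc : uIcc α ℓ = Icc α ℓ := uIcc_of_le hα.2.le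
    have hsub : uIcc α ℓ ⊆ Ioc 0 ℓ := by
      rw [huIcc]
      exact fun x hx => ⟨hα.1.trans_le hx.1, hx.2⟩
    have hacu : AbsolutelyContinuousOnInterval u α ℓ :=
      hu1.contDiffOn.absolutelyContinuousOnInterval
    have hacρ : AbsolutelyContinuousOnInterval ρ α ℓ :=
      (hρc.mono hsub).absolutelyContinuousOnInterval
    have hacF : AbsolutelyContinuousOnInterval F α ℓ :=
      ((hacu.mul (h.absolutelyContinuousOnInterval α ℓ)).const_mul (-2 * σ)).add
        (((hacu.mul hacu).mul hacρ).const_mul σ)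
    rw [← hacF.integral_deriv_eq_sub]
    refine intervalIntegral.integral_mono_ae_restrict hα.2.le hacF.intervalIntegrable_deriv
      (hqi _ _) ?_
    rw [Filter.EventuallyLE, ae_restrict_iff' measurableSet_Icc]
    filter_upwards [h.ae_hasDerivAt] with x hx hxI
    have hxI' : x ∈ Ioc 0 ℓ := hsub (huIcc ▸ hxI)
    have hd := (((hdu x).mul hx).const_mul (-2 * σ)).add
      ((((hdu x).mul (hdu x)).mul (hρ x hxI')).const_mul σ)
    have hd' : deriv F x = _ := hd.deriv
    rw [hd']
    have hkx := hkpos x hxI'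
    have h1 := hle x hxI'
    have h2 : σ * (u x ^ 2 * ρ' x) ≤ σ * (u x ^ 2 * (-(σ / k x) - ρ x ^ 2)) :=
      mul_le_mul_of_nonneg_left (mul_le_mul_of_nonneg_left h1 (sq_nonneg _)) hσ.le
    -- By the Riccati inequality these two squares bound `g² k - σ V² - F'` from below. They vanish
    -- when `k v' = -σ u` and `u' = ρ u`, the eigenvalue equation.
    have h3 : 0 ≤ k x * (g x + σ / k x * u x) ^ 2 + σ * (V x - u x * ρ x) ^ 2 := by positivity
    have h4 : k x * (g x + σ / k x * u x) ^ 2 =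
        k x * g x ^ 2 + 2 * σ * (g x * u x) + σ * (u x ^ 2 * (σ / k x)) := by
      field_simp
      ring
    simp only [hq, Pi.mul_apply]
    rw [h4] at h3
    nlinarith [h2, h3]
  have hlimq : Filter.Tendsto (fun α => ∫ x in α..ℓ, q x) (nhdsWithin 0 (Ioi 0))
      (nhds (∫ x in (0 : ℝ)..ℓ, q x)) := by
    have h1 : Continuous fun α => ∫ x in (ℓ)..α, q x :=
      intervalIntegral.continuous_primitive hqi ℓ
    have h2 := (h1.tendsto 0).mono_left (nhdsWithin_le_nhds (s := Ioi (0 : ℝ)))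
    have h3 := h2.neg
    rw [← intervalIntegral.integral_symm] at h3
    exact h3.congr fun α => (intervalIntegral.integral_symm _ _).symm
  have hlimF : Filter.Tendsto (fun α => F ℓ - F α) (nhdsWithin 0 (Ioi 0)) (nhds (F ℓ - 0)) := by
    refine tendsto_const_nhds.sub ?_
    have hu0 : u 0 = 0 := intervalIntegral.integral_same
    have hmono := nhdsWithin_le_nhds (a := (0 : ℝ)) (s := Ioi 0)
    have h1 : Filter.Tendsto u (nhdsWithin 0 (Ioi 0)) (nhds 0) := by
      have := (hdu 0).continuousAt.tendsto.mono_left hmono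
      rwa [hu0] at this
    have h2 : Filter.Tendsto V (nhdsWithin 0 (Ioi 0)) (nhds (V 0)) :=
      (h.continuous.tendsto 0).mono_left hmono
    have h3 : Filter.Tendsto (fun x => x⁻¹ * u x) (nhdsWithin 0 (Ioi 0)) (nhds (V 0)) := by
      have := (hasDerivAt_iff_tendsto_slope_zero.1 (hdu 0)).mono_left
        (nhdsWithin_mono 0 (s := Ioi 0) fun x hx => ne_of_gt hx)
      simpa [hu0] using this
    -- Near 0 one writes `u² ρ = u · (u/x) · (xρ)`, with limit `0 · V(0) · r = 0`.
    have h4 := ((h1.mul h2).const_mul (-2 * σ)).add (((h1.mul h3).mul hr).const_mul σ)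
    simp only [zero_mul, mul_zero, add_zero] at h4
    refine h4.congr' ?_
    filter_upwards [self_mem_nhdsWithin] with x hx
    have hx0 : x ≠ 0 := ne_of_gt hx
    simp only [hF]
    field_simp
  have hfin := le_of_tendsto_of_tendsto hlimF hlimq
    (Filter.eventually_of_mem (Ioo_mem_nhdsGT hℓ) hstep)
  rw [hq, intervalIntegral.integral_sub (hgk _ _) (hVsq _ _),
    intervalIntegral.integral_const_mul] at hfin
  simp only [hF] at hfin
  nlinarith [hfin]

/-- For `k = 2x/ℓ` and `σ = 2τ` the equation `u'' = -σ u / k` is solved by `u = x f₁(τℓx)` with `u'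
= f₀(τℓx)`, by the relation `y f₂ = f₁ - f₀`. Then `ρ = u'/u`, and positivity of `f₁` keeps it
finite up to `ℓ`. -/
theorem le_integral_linear_weight (h : IsSobolevPrimitive V g) {τ ℓ : ℝ} (hτ : 0 < τ)
    (hℓ : 0 < ℓ) (hpos : ∀ y ∈ Icc 0 (τ * ℓ ^ 2), 0 < besselSeries 1 y) :
    2 * τ * (∫ x in (0 : ℝ)..ℓ, V x ^ 2) - 2 * (2 * τ) * (∫ x in (0 : ℝ)..ℓ, V x) * V ℓ +
      2 * τ * (∫ x in (0 : ℝ)..ℓ, V x) ^ 2 *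
        (besselSeries 0 (τ * ℓ ^ 2) / (ℓ * besselSeries 1 (τ * ℓ ^ 2))) ≤
      ∫ x in (0 : ℝ)..ℓ, g x ^ 2 * (2 / ℓ * x) := by
  have hpos' : ∀ x ∈ Icc 0 ℓ, 0 < besselSeries 1 (τ * ℓ * x) := fun x hx => by
    refine hpos _ ⟨by have := hx.1; positivity, ?_⟩
    rw [sq, ← mul_assoc]
    exact mul_le_mul_of_nonneg_left hx.2 (by positivity)
  have hd : ∀ m x, HasDerivAt (fun x => besselSeries m (τ * ℓ * x))
      (-besselSeries (m + 1) (τ * ℓ * x) * (τ * ℓ)) x := fun m x => by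
    have h1 : HasDerivAt (fun x : ℝ => τ * ℓ * x) (τ * ℓ) x := by
      simpa using (hasDerivAt_id x).const_mul (τ * ℓ)
    exact (hasDerivAt_besselSeries m (τ * ℓ * x)).comp x h1
  have hcd : ∀ m, ContDiff ℝ 1 fun x => besselSeries m (τ * ℓ * x) := fun m =>
    (contDiff_besselSeries m 1).comp (contDiff_const.mul contDiff_id)
  have key := h.le_integral_of_riccati (k := fun x => 2 / ℓ * x)
    (ρ := fun x => besselSeries 0 (τ * ℓ * x) / (x * besselSeries 1 (τ * ℓ * x)))
    (ρ' := fun x => -(2 * τ / (2 / ℓ * x)) -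
      (besselSeries 0 (τ * ℓ * x) / (x * besselSeries 1 (τ * ℓ * x))) ^ 2) (σ := 2 * τ)
    (r := besselSeries 0 (τ * ℓ * 0) / besselSeries 1 (τ * ℓ * 0))
    (by positivity) hℓ (by fun_prop) (fun x hx => by have := hx.1; positivity)
    (fun x hx => ?_) ?_ ?_ (fun x _ => le_rfl)
  · rw [show τ * ℓ ^ 2 = τ * ℓ * ℓ by ring]
    exact key
  · have hx0 : x ≠ 0 := hx.1.ne'
    have hb : besselSeries 1 (τ * ℓ * x) ≠ 0 := (hpos' x ⟨hx.1.le, hx.2⟩).ne'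
    refine ((hd 0 x).div ((hasDerivAt_id' x).mul (hd 1 x)) (mul_ne_zero hx0 hb)).congr_deriv ?_
    have h2 := mul_besselSeries_two (τ * ℓ * x)
    have h3 : besselSeries 0 (τ * ℓ * x) =
      besselSeries 1 (τ * ℓ * x) - τ * ℓ * x * besselSeries 2 (τ * ℓ * x) := by linarith
    simp only [zero_add, one_add_one_eq_two, Pi.mul_apply]
    rw [h3]
    field_simp
    ring
  · refine ContDiffOn.div (hcd 0).contDiffOn (contDiff_id.mul (hcd 1)).contDiffOn fun x hx => ?_
    exact mul_ne_zero hx.1.ne' (hpos' x ⟨hx.1.le, hx.2⟩).ne'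
  · have h1 : ContinuousAt (fun x => besselSeries 0 (τ * ℓ * x) / besselSeries 1 (τ * ℓ * x)) 0 :=
      (hd 0 0).continuousAt.div (hd 1 0).continuousAt (hpos' 0 ⟨le_rfl, hℓ.le⟩).ne'
    refine (h1.tendsto.mono_left (nhdsWithin_le_nhds (s := Ioi 0))).congr' ?_
    filter_upwards [self_mem_nhdsWithin] with x hx
    have hx0 : x ≠ 0 := ne_of_gt hx
    rw [mul_div_assoc', mul_div_mul_left _ _ hx0]

theorem integral_comp_one_sub_eq (h : IsSobolevPrimitive V g)
    (h0 : ∫ x in (0 : ℝ)..1, V x = 0) (a : ℝ) :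
    ∫ x in (0 : ℝ)..(1 - a), V (1 - x) = -∫ x in (0 : ℝ)..a, V x := by
  rw [intervalIntegral.integral_comp_sub_left, sub_zero, sub_sub_cancel]
  have := intervalIntegral.integral_add_adjacent_intervals
    (h.continuous.intervalIntegrable (μ := volume) 0 a) (h.continuous.intervalIntegrable a 1)
  linarith

theorem integral_sq_add (h : IsSobolevPrimitive V g) (a : ℝ) :
    (∫ x in (0 : ℝ)..a, V x ^ 2) + ∫ x in (0 : ℝ)..(1 - a), V (1 - x) ^ 2 =
      ∫ x in (0 : ℝ)..1, V x ^ 2 := by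
  rw [intervalIntegral.integral_comp_sub_left (fun x => V x ^ 2), sub_zero, sub_sub_cancel]
  exact intervalIntegral.integral_add_adjacent_intervals
    ((h.continuous.pow 2).intervalIntegrable _ _) ((h.continuous.pow 2).intervalIntegrable _ _)

/-- The Poincaré inequality for functions of mean zero with constant `8`. -/
theorem eight_mul_integral_sq_le (h : IsSobolevPrimitive V g)
    (h0 : ∫ x in (0 : ℝ)..1, V x = 0) :
    8 * ∫ x in (0 : ℝ)..1, V x ^ 2 ≤ ∫ x in (0 : ℝ)..1, g x ^ 2 := by
  have half : ∀ {V g : ℝ → ℝ}, IsSobolevPrimitive V g →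
      8 * (∫ x in (0 : ℝ)..(1 / 2), V x ^ 2) - 2 * 8 * (∫ x in (0 : ℝ)..(1 / 2), V x) * V (1 / 2)
        ≤ ∫ x in (0 : ℝ)..(1 / 2), g x ^ 2 := by
    intro V g h
    have hne : ∀ x ∈ Ioc (0 : ℝ) (1 / 2), x * (1 - x) ≠ 0 := fun x hx =>
      mul_ne_zero hx.1.ne' (by linarith [hx.2])
    -- Here `ρ = u'/u` with `u = x(1-x)`, and `u'' = -2 ≤ -8u` because `u ≤ 1/4`. Since `ρ(1/2) =
    -- 0`, the quadratic boundary term disappears.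
    have key := h.le_integral_of_riccati (k := fun _ => 1)
      (ρ := fun x => (1 - 2 * x) / (x * (1 - x)))
      (ρ' := fun x => -(2 / (x * (1 - x))) - ((1 - 2 * x) / (x * (1 - x))) ^ 2) (σ := 8)
      (ℓ := 1 / 2) (r := (1 - 2 * 0) / (1 - 0))
      (by norm_num) (by norm_num) continuous_const (fun x _ => one_pos)
      (fun x hx => ?_) ?_ ?_ (fun x hx => ?_)
    · norm_num at key
      norm_num
      linarith
    · have h1 : HasDerivAt (fun x : ℝ => 1 - 2 * x) (-2) x := by
        simpa using ((hasDerivAt_id x).const_mul 2).const_sub 1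
      have h2 : HasDerivAt (fun x : ℝ => x * (1 - x)) (1 - 2 * x) x := by
        refine ((hasDerivAt_id' x).mul ((hasDerivAt_id' x).const_sub 1)).congr_deriv ?_
        ring
      refine (h1.div h2 (hne x hx)).congr_deriv ?_
      have hx0 : x ≠ 0 := hx.1.ne'
      have hx1 : 1 - x ≠ 0 := by linarith [hx.2]
      field_simp
    · exact ContDiffOn.div (by fun_prop) (by fun_prop) hne
    · have h1 : ContinuousAt (fun x : ℝ => (1 - 2 * x) / (1 - x)) 0 :=
        ContinuousAt.div (by fun_prop) (by fun_prop) (by norm_num)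
      refine (h1.tendsto.mono_left (nhdsWithin_le_nhds (s := Ioi 0))).congr' ?_
      filter_upwards [self_mem_nhdsWithin] with x hx
      have hx0 : x ≠ 0 := ne_of_gt hx
      rw [mul_div_assoc', mul_div_mul_left _ _ hx0]
    · have hx1 : 0 < x * (1 - x) := mul_pos hx.1 (by linarith [hx.2])
      have : (8 : ℝ) ≤ 2 / (x * (1 - x)) := by
        rw [le_div_iff₀ hx1]
        nlinarith [sq_nonneg (2 * x - 1)]
      simp only [div_one]
      linarith
  have h1 := half h
  have h2 := half h.comp_one_sub
  have h3 := h.integral_comp_one_sub_eq h0 (1 / 2)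
  have h4 := h.integral_sq_add (1 / 2)
  have h5 : (∫ x in (0 : ℝ)..(1 / 2), g x ^ 2) + ∫ x in (0 : ℝ)..(1 / 2), (-g (1 - x)) ^ 2 =
      ∫ x in (0 : ℝ)..1, g x ^ 2 := by
    simp only [neg_sq]
    rw [intervalIntegral.integral_comp_sub_left (fun x => g x ^ 2)]
    norm_num
    exact intervalIntegral.integral_add_adjacent_intervals h.integrable_sq.intervalIntegrable
      h.integrable_sq.intervalIntegrable
  rw [show (1 : ℝ) - 1 / 2 = 1 / 2 by norm_num] at h2 h3 h4
  rw [h3] at h2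
  nlinarith

end IsSobolevPrimitive

/-! ### Tents -/

/-- The Green function of `-d²/dx²` on `(0,1)` with Dirichlet boundary conditions. -/
def dirichletGreen (x a : ℝ) : ℝ := min x a - x * a

theorem continuous_dirichletGreen (a : ℝ) : Continuous fun x => dirichletGreen x a := by
  unfold dirichletGreen
  fun_prop

/-- Up to the factor `a(1-a)/2`, the tent is a linear weight on each side of its peak, so the linear
case applies to `V` on `(0,a)` and to its reflection on `(0,1-a)`. Mean zero makes the two integrals
of `V` opposite: the terms linear in `V(a)` cancel, and the quadratic ones add up with the factor
that `hkink` controls. -/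
theorem IsSobolevPrimitive.le_integral_dirichletGreen {V g : ℝ → ℝ} (h : IsSobolevPrimitive V g)
    (h0 : ∫ x in (0 : ℝ)..1, V x = 0) {τ a : ℝ} (hτ : 0 < τ) (ha : a ∈ Ioo (0 : ℝ) 1)
    (hpa : ∀ y ∈ Icc 0 (τ * a ^ 2), 0 < besselSeries 1 y)
    (hpb : ∀ y ∈ Icc 0 (τ * (1 - a) ^ 2), 0 < besselSeries 1 y)
    (hkink : 0 ≤ besselSeries 0 (τ * a ^ 2) * ((1 - a) * besselSeries 1 (τ * (1 - a) ^ 2)) +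
      besselSeries 0 (τ * (1 - a) ^ 2) * (a * besselSeries 1 (τ * a ^ 2))) :
    τ * (a * (1 - a)) * ∫ x in (0 : ℝ)..1, V x ^ 2 ≤
      ∫ x in (0 : ℝ)..1, g x ^ 2 * dirichletGreen x a := by
  have ha0 := ha.1
  have hb0 : 0 < 1 - a := sub_pos.2 ha.2
  have h1 := h.le_integral_linear_weight hτ ha0 hpa
  have h2 := h.comp_one_sub.le_integral_linear_weight hτ hb0 hpb
  rw [h.integral_comp_one_sub_eq h0 a] at h2
  have h4 := h.integral_sq_add a
  have hgi := h.intervalIntegrable_sq_mul (continuous_dirichletGreen a)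
  have h5 : ∫ x in (0 : ℝ)..a, g x ^ 2 * dirichletGreen x a =
      a * (1 - a) / 2 * ∫ x in (0 : ℝ)..a, g x ^ 2 * (2 / a * x) := by
    rw [← intervalIntegral.integral_const_mul]
    refine intervalIntegral.integral_congr fun x hx => ?_
    rw [uIcc_of_le ha0.le] at hx
    simp only [dirichletGreen, min_eq_left hx.2]
    field_simp
  have h6 : ∫ x in a..1, g x ^ 2 * dirichletGreen x a =
      a * (1 - a) / 2 * ∫ x in (0 : ℝ)..(1 - a), (-g (1 - x)) ^ 2 * (2 / (1 - a) * x) := by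
    have h7 : ∫ x in (0 : ℝ)..(1 - a), (-g (1 - x)) ^ 2 * (2 / (1 - a) * x) =
        ∫ x in (0 : ℝ)..(1 - a), (fun y => g y ^ 2 * (2 / (1 - a) * (1 - y))) (1 - x) := by
      refine intervalIntegral.integral_congr fun x _ => ?_
      simp only [neg_sq, sub_sub_cancel]
    rw [h7, intervalIntegral.integral_comp_sub_left
      (fun y => g y ^ 2 * (2 / (1 - a) * (1 - y))), sub_zero, sub_sub_cancel,
      ← intervalIntegral.integral_const_mul]
    refine intervalIntegral.integral_congr fun x hx => ?_
    rw [uIcc_of_le ha.2.le] at hx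
    simp only [dirichletGreen, min_eq_right hx.1]
    field_simp
  rw [← intervalIntegral.integral_add_adjacent_intervals (hgi 0 a) (hgi a 1), h5, h6, ← mul_add]
  have hfa := hpa _ ⟨by positivity, le_rfl⟩
  have hfb := hpb _ ⟨by positivity, le_rfl⟩
  have hk : 0 ≤ besselSeries 0 (τ * a ^ 2) / (a * besselSeries 1 (τ * a ^ 2)) +
      besselSeries 0 (τ * (1 - a) ^ 2) / ((1 - a) * besselSeries 1 (τ * (1 - a) ^ 2)) := by
    rw [div_add_div _ _ (by positivity) (by positivity)]
    refine div_nonneg ?_ (by positivity)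
    linarith
  have hk2 := mul_nonneg (mul_nonneg hτ.le (sq_nonneg (∫ x in (0 : ℝ)..a, V x))) hk
  rw [sub_sub_cancel] at h2
  have h8 : 2 * τ * ∫ x in (0 : ℝ)..1, V x ^ 2 ≤
      (∫ x in (0 : ℝ)..a, g x ^ 2 * (2 / a * x)) +
        ∫ x in (0 : ℝ)..(1 - a), (-g (1 - x)) ^ 2 * (2 / (1 - a) * x) := by
    rw [← h4]
    linarith
  have h9 := mul_le_mul_of_nonneg_left h8 (show 0 ≤ a * (1 - a) / 2 by positivity)
  linarith

/-! ### Concave functions as limits of combinations of tents -/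

/-- A nonnegative concave function on `(0,1)`, extended by zero, is concave on `[0,1]`. -/
theorem concaveOn_indicator_Ioo {h : ℝ → ℝ} (hc : ConcaveOn ℝ (Ioo (0 : ℝ) 1) h)
    (h0 : ∀ x ∈ Ioo (0 : ℝ) 1, 0 ≤ h x) :
    ConcaveOn ℝ (Icc (0 : ℝ) 1) ((Ioo (0 : ℝ) 1).indicator h) := by
  have hnn : ∀ x, 0 ≤ (Ioo (0 : ℝ) 1).indicator h x := fun x => indicator_nonneg h0 x
  have hopen : ∀ e ∈ Icc (0 : ℝ) 1, ∀ y ∈ Ioo (0 : ℝ) 1, ∀ t ∈ Ioc (0 : ℝ) 1,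
      (1 - t) * e + t * y ∈ Ioo (0 : ℝ) 1 := by
    intro e he y hy t ht
    constructor
    · nlinarith [mul_nonneg (sub_nonneg.2 ht.2) he.1, mul_pos ht.1 hy.1]
    · nlinarith [mul_nonneg (sub_nonneg.2 ht.2) (sub_nonneg.2 he.2),
        mul_pos ht.1 (sub_pos.2 hy.2)]
  have hstar : ∀ e ∈ Icc (0 : ℝ) 1, ∀ y ∈ Ioo (0 : ℝ) 1, ∀ b ∈ Ioo (0 : ℝ) 1,
      b * h y ≤ h ((1 - b) * e + b * y) := by
    intro e he y hy b hb
    -- The end point `e` is replaced by the interior point `(1-t)e + ty`. Concavity holds there, the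
    -- value of `h` at that point is dropped as nonnegative, and `t → 0`.
    have hlim : Filter.Tendsto (fun t : ℝ => (1 - (1 - b) / (1 - t)) * h y)
        (nhdsWithin 0 (Ioi 0)) (nhds (b * h y)) := by
      have h1 : ContinuousAt (fun t : ℝ => (1 - (1 - b) / (1 - t)) * h y) 0 := by
        refine ContinuousAt.mul (ContinuousAt.sub continuousAt_const
          (ContinuousAt.div (by fun_prop) (by fun_prop) (by norm_num))) continuousAt_const
      have h2 := h1.tendsto
      simp only [sub_zero, div_one, sub_sub_cancel] at h2
      exact h2.mono_left nhdsWithin_le_nhds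
    refine le_of_tendsto hlim ?_
    filter_upwards [Ioo_mem_nhdsGT hb.1] with t ht
    have ht1 : 0 < 1 - t := by linarith [ht.2, hb.2]
    have hs0 : 0 ≤ (1 - b) / (1 - t) := div_nonneg (by linarith [hb.2]) ht1.le
    have hs1 : 0 ≤ 1 - (1 - b) / (1 - t) := by
      rw [sub_nonneg, div_le_one ht1]
      linarith [ht.2]
    have het := hopen e he y hy t ⟨ht.1, by linarith⟩
    have h3 := hc.2 het hy hs0 hs1 (by ring)
    have h4 : ((1 - b) / (1 - t)) • ((1 - t) * e + t * y) + (1 - (1 - b) / (1 - t)) • y =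
        (1 - b) * e + b * y := by
      simp only [smul_eq_mul]
      field_simp
      ring
    rw [h4, smul_eq_mul, smul_eq_mul] at h3
    have h5 := mul_nonneg hs0 (h0 _ het)
    linarith
  have hzero : ∀ x, x ∉ Ioo (0 : ℝ) 1 → (Ioo (0 : ℝ) 1).indicator h x = 0 := fun x hx =>
    indicator_of_notMem hx h
  have hone : ∀ x, x ∈ Ioo (0 : ℝ) 1 → (Ioo (0 : ℝ) 1).indicator h x = h x := fun x hx =>
    indicator_of_mem hx h
  refine ⟨convex_Icc 0 1, fun x hx y hy a b ha hb hab => ?_⟩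
  simp only [smul_eq_mul]
  rcases ha.eq_or_lt with rfl | ha
  · obtain rfl : b = 1 := by linarith
    simp
  rcases hb.eq_or_lt with rfl | hb
  · obtain rfl : a = 1 := by linarith
    simp
  by_cases hxi : x ∈ Ioo (0 : ℝ) 1
  · by_cases hyi : y ∈ Ioo (0 : ℝ) 1
    · have h1 := hc.1 hxi hyi ha.le hb.le hab
      have h2 := hc.2 hxi hyi ha.le hb.le hab
      simp only [smul_eq_mul] at h1 h2
      rw [hone x hxi, hone y hyi, hone _ h1]
      exact h2
    · have h1 := hopen y hy x hxi a ⟨ha, by linarith⟩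
      have h2 := hstar y hy x hxi a ⟨ha, by linarith⟩
      rw [show 1 - a = b by linarith, add_comm] at h1 h2
      rw [hone x hxi, hzero y hyi, hone _ h1]
      linarith
  · by_cases hyi : y ∈ Ioo (0 : ℝ) 1
    · have h1 := hopen x hx y hyi b ⟨hb, by linarith⟩
      have h2 := hstar x hx y hyi b ⟨hb, by linarith⟩
      rw [show 1 - b = a by linarith] at h1 h2
      rw [hone y hyi, hzero x hxi, hone _ h1]
      linarith
    · rw [hzero x hxi, hzero y hyi]
      simpa using hnn _

/-- Summation by parts twice, the discrete form of Green's second identity. -/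
theorem sum_range_secondDiff_mul (a b : ℕ → ℝ) (N : ℕ) :
    ∑ k ∈ Finset.range N, (2 * a (k + 1) - a k - a (k + 2)) * b (k + 1) =
      ∑ k ∈ Finset.range N, a (k + 1) * (2 * b (k + 1) - b k - b (k + 2)) +
        (a N * b (N + 1) - a (N + 1) * b N) - (a 0 * b 1 - a 1 * b 0) := by
  induction N with
  | zero => simp
  | succ N ih =>
    rw [Finset.sum_range_succ, Finset.sum_range_succ, ih]
    ring

/-- The piecewise linear interpolation of `H` at the nodes `k/(N+1)`, `0 < k < N+1`, with value zero
at the end points, written as a combination of Green functions. -/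
noncomputable def tentInterpolation (H : ℝ → ℝ) (N : ℕ) (x : ℝ) : ℝ :=
  ∑ k ∈ Finset.range N, ((N : ℝ) + 1) * (2 * H (((k + 1 : ℕ) : ℝ) / (N + 1)) -
    H ((k : ℝ) / (N + 1)) - H (((k + 2 : ℕ) : ℝ) / (N + 1))) *
      dirichletGreen x (((k + 1 : ℕ) : ℝ) / (N + 1))

theorem continuous_tentInterpolation (H : ℝ → ℝ) (N : ℕ) : Continuous (tentInterpolation H N) :=
  continuous_finsetSum _ fun _ _ => continuous_const.mul (continuous_dirichletGreen _)

/-- Summation by parts moves the second difference from `H` to the Green function in its peak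
variable. There it is a hat function of the node, nonzero at most at the two nodes `m` and `m + 1`
around `(N+1)x`; the boundary terms vanish with `H` and `G`. -/
theorem tentInterpolation_eq {H : ℝ → ℝ} (h0 : H 0 = 0) (h1 : H 1 = 0) {N m : ℕ} (hm : m ≤ N)
    {x : ℝ} (hx : (m : ℝ) ≤ (N + 1) * x) (hx' : (N + 1) * x ≤ m + 1) :
    tentInterpolation H N x = (m + 1 - (N + 1) * x) * H ((m : ℝ) / (N + 1)) +
      ((N + 1) * x - m) * H (((m + 1 : ℕ) : ℝ) / (N + 1)) := by
  have hN : (0 : ℝ) < (N : ℝ) + 1 := by positivity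
  have hx1 : (N + 1) * x ≤ N + 1 := hx'.trans (by exact_mod_cast Nat.succ_le_succ hm)
  have hx01 : x ≤ 1 := by nlinarith
  have hx00 : 0 ≤ x := by
    have : (0 : ℝ) ≤ (N + 1) * x := (Nat.cast_nonneg m).trans hx
    by_contra! hneg
    nlinarith
  set a : ℕ → ℝ := fun k => H ((k : ℝ) / (N + 1)) with ha
  set b : ℕ → ℝ := fun k => (N + 1) * dirichletGreen x ((k : ℝ) / (N + 1)) with hb
  have ha0 : a 0 = 0 := by simp [ha, h0]
  have haN : a (N + 1) = 0 := by
    simp only [ha]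
    push_cast
    rw [div_self hN.ne', h1]
  have hb0 : b 0 = 0 := by simp [hb, dirichletGreen, hx00]
  have hbN : b (N + 1) = 0 := by
    simp only [hb]
    push_cast
    rw [div_self hN.ne', dirichletGreen, min_eq_left hx01]
    ring
  have hlow : ∀ k : ℕ, k ≤ m → b k = k - k * x := by
    intro k hk
    have : (k : ℝ) / (N + 1) ≤ x := by
      rw [div_le_iff₀ hN, mul_comm]
      exact (Nat.cast_le.2 hk).trans hx
    simp only [hb, dirichletGreen, min_eq_right this]
    field_simp
  have hhigh : ∀ k : ℕ, m + 1 ≤ k → b k = (N + 1) * x - k * x := by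
    intro k hk
    have : x ≤ (k : ℝ) / (N + 1) := by
      rw [le_div_iff₀ hN, mul_comm]
      exact hx'.trans (by exact_mod_cast hk)
    simp only [hb, dirichletGreen, min_eq_left this]
    field_simp
  have hhat : ∀ k : ℕ, 2 * b (k + 1) - b k - b (k + 2) =
      (if k + 1 = m then (m : ℝ) + 1 - (N + 1) * x else 0) +
        if k + 1 = m + 1 then (N + 1) * x - m else 0 := by
    intro k
    rcases lt_trichotomy (k + 1) m with hk | hk | hk
    · rw [hlow (k + 1) (by omega), hlow k (by omega), hlow (k + 2) (by omega),
        if_neg (by omega), if_neg (by omega)]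
      push_cast
      ring
    · rw [hlow (k + 1) (by omega), hlow k (by omega), hhigh (k + 2) (by omega),
        if_pos hk, if_neg (by omega), ← hk]
      push_cast
      ring
    · rcases Nat.eq_or_lt_of_le (show m ≤ k by omega) with rfl | hk'
      · rw [hhigh (m + 1) (by omega), hlow m le_rfl, hhigh (m + 2) (by omega),
          if_neg (by omega), if_pos rfl]
        push_cast
        ring
      · rw [hhigh (k + 1) (by omega), hhigh k (by omega), hhigh (k + 2) (by omega),
          if_neg (by omega), if_neg (by omega)]
        push_cast
        ring
  have hsum : tentInterpolation H N x =
      ∑ k ∈ Finset.range N, (2 * a (k + 1) - a k - a (k + 2)) * b (k + 1) := by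
    refine Finset.sum_congr rfl fun k _ => ?_
    simp only [ha, hb]
    ring
  have hdelta : ∀ j ≤ N + 1, ∀ z : ℝ,
      ∑ k ∈ Finset.range N, a (k + 1) * (if k + 1 = j then z else 0) = a j * z := by
    intro j hj z
    have h2 : ∑ k ∈ Finset.range (N + 2), a k * (if k = j then z else 0) = a j * z := by
      simp only [mul_ite, mul_zero, Finset.sum_ite_eq', Finset.mem_range]
      rw [if_pos (by omega)]
    rw [Finset.sum_range_succ, haN, zero_mul, add_zero, Finset.sum_range_succ', ha0, zero_mul,
      add_zero] at h2
    exact h2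
  rw [hsum, sum_range_secondDiff_mul, ha0, haN, hb0, hbN]
  simp only [hhat, mul_add, Finset.sum_add_distrib]
  rw [hdelta m (by omega), hdelta (m + 1) (by omega)]
  simp only [ha]
  ring

/-- The nonnegative concave functions on `(0,1)`. -/
structure IsConcaveNonneg (h : ℝ → ℝ) : Prop where
  nonneg : ∀ x ∈ Ioo (0 : ℝ) 1, 0 ≤ h x
  concave : ConcaveOn ℝ (Ioo (0 : ℝ) 1) h

namespace IsConcaveNonneg

variable {h : ℝ → ℝ}

/-- Concavity at the midpoint of `x` and `1 - x`. This bound, inherited by all interpolations,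
supplies the majorant for dominated convergence. -/
theorem le_two_mul_half (hh : IsConcaveNonneg h) {x : ℝ} (hx : x ∈ Ioo (0 : ℝ) 1) :
    h x ≤ 2 * h (1 / 2) := by
  have hx' : 1 - x ∈ Ioo (0 : ℝ) 1 := ⟨by linarith [hx.2], by linarith [hx.1]⟩
  have h1 := hh.concave.2 hx hx' (by norm_num : (0 : ℝ) ≤ 1 / 2) (by norm_num : (0 : ℝ) ≤ 1 / 2)
    (by norm_num)
  have h2 := hh.nonneg _ hx'
  simp only [smul_eq_mul] at h1
  rw [show 1 / 2 * x + 1 / 2 * (1 - x) = 1 / 2 by ring] at h1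
  linarith

theorem indicator_mem_Icc (hh : IsConcaveNonneg h) (x : ℝ) :
    (Ioo (0 : ℝ) 1).indicator h x ∈ Icc 0 (2 * h (1 / 2)) := by
  have h0 : 0 ≤ h (1 / 2) := hh.nonneg _ ⟨by norm_num, by norm_num⟩
  by_cases hx : x ∈ Ioo (0 : ℝ) 1
  · rw [indicator_of_mem hx]
    exact ⟨hh.nonneg x hx, hh.le_two_mul_half hx⟩
  · rw [indicator_of_notMem hx]
    exact ⟨le_rfl, by linarith⟩

theorem exists_tentInterpolation_eq (h : ℝ → ℝ) (N : ℕ) {x : ℝ}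
    (hx : x ∈ Ioo (0 : ℝ) 1) :
    ∃ t ∈ Icc (0 : ℝ) 1, tentInterpolation ((Ioo (0 : ℝ) 1).indicator h) N x =
      (Ioo (0 : ℝ) 1).indicator h (((⌊((N : ℝ) + 1) * x⌋₊ + 1 : ℕ) : ℝ) / (N + 1)) + t *
        ((Ioo (0 : ℝ) 1).indicator h ((⌊((N : ℝ) + 1) * x⌋₊ : ℝ) / (N + 1)) -
          (Ioo (0 : ℝ) 1).indicator h (((⌊((N : ℝ) + 1) * x⌋₊ + 1 : ℕ) : ℝ) / (N + 1))) := by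
  set m := ⌊((N : ℝ) + 1) * x⌋₊ with hm
  have hN : (0 : ℝ) < (N : ℝ) + 1 := by positivity
  have h1 : (m : ℝ) ≤ (N + 1) * x := Nat.floor_le (mul_pos hN hx.1).le
  have h2 : (N + 1) * x < m + 1 := Nat.lt_floor_add_one _
  have hmN : m ≤ N := by
    have : (m : ℝ) < N + 1 := h1.trans_lt (by nlinarith [hx.2])
    exact Nat.lt_succ_iff.1 (by exact_mod_cast this)
  refine ⟨m + 1 - (N + 1) * x, ⟨by linarith, by linarith⟩, ?_⟩
  rw [tentInterpolation_eq (by simp) (by simp) hmN h1 h2.le]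
  ring

theorem tentInterpolation_mem_Icc (hh : IsConcaveNonneg h) (N : ℕ) {x : ℝ}
    (hx : x ∈ Ioo (0 : ℝ) 1) :
    tentInterpolation ((Ioo (0 : ℝ) 1).indicator h) N x ∈ Icc 0 (2 * h (1 / 2)) := by
  obtain ⟨t, ht, h1⟩ := exists_tentInterpolation_eq h N hx
  have h2 := (convex_Icc 0 (2 * h (1 / 2))).add_smul_sub_mem
    (hh.indicator_mem_Icc (((⌊((N : ℝ) + 1) * x⌋₊ + 1 : ℕ) : ℝ) / (N + 1)))
    (hh.indicator_mem_Icc ((⌊((N : ℝ) + 1) * x⌋₊ : ℝ) / (N + 1))) ht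
  rw [h1]
  exact h2

theorem tendsto_tentInterpolation (hh : IsConcaveNonneg h) {x : ℝ} (hx : x ∈ Ioo (0 : ℝ) 1) :
    Filter.Tendsto (fun N => tentInterpolation ((Ioo (0 : ℝ) 1).indicator h) N x) Filter.atTop
      (nhds (h x)) := by
  have hcont : ContinuousAt ((Ioo (0 : ℝ) 1).indicator h) x := by
    have h1 : ContinuousAt h x :=
      (hh.concave.continuousOn isOpen_Ioo).continuousAt (isOpen_Ioo.mem_nhds hx)
    refine h1.congr ?_
    filter_upwards [isOpen_Ioo.mem_nhds hx] with y hy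
    rw [indicator_of_mem hy]
  have hval : (Ioo (0 : ℝ) 1).indicator h x = h x := indicator_of_mem hx h
  have hN : Filter.Tendsto (fun N : ℕ => (N : ℝ) + 1) Filter.atTop Filter.atTop :=
    Filter.tendsto_atTop_add_const_right _ _ tendsto_natCast_atTop_atTop
  have hl : Filter.Tendsto (fun N : ℕ => (⌊((N : ℝ) + 1) * x⌋₊ : ℝ) / ((N : ℝ) + 1)) Filter.atTop
      (nhds x) := by
    have := (tendsto_nat_floor_mul_div_atTop hx.1.le).comp hN
    refine this.congr fun N => ?_
    simp only [Function.comp, mul_comm]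
  have hr : Filter.Tendsto (fun N : ℕ => ((⌊((N : ℝ) + 1) * x⌋₊ + 1 : ℕ) : ℝ) / ((N : ℝ) + 1))
      Filter.atTop (nhds x) := by
    have := hl.add (tendsto_inv_atTop_zero.comp hN)
    rw [add_zero] at this
    refine this.congr fun N => ?_
    simp only [Function.comp]
    push_cast
    rw [add_div, one_div]
  have hHl := hcont.tendsto.comp hl
  have hHr := hcont.tendsto.comp hr
  rw [hval] at hHl hHr
  have hdiff := hHl.sub hHr
  rw [sub_self] at hdiff
  choose t ht h1 using fun N => exists_tentInterpolation_eq h N hx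
  have h2 : Filter.Tendsto (fun N => t N * (((Ioo (0 : ℝ) 1).indicator h)
      ((⌊((N : ℝ) + 1) * x⌋₊ : ℝ) / (N + 1)) - ((Ioo (0 : ℝ) 1).indicator h)
        (((⌊((N : ℝ) + 1) * x⌋₊ + 1 : ℕ) : ℝ) / (N + 1)))) Filter.atTop (nhds 0) := by
    refine bdd_le_mul_tendsto_zero' 1 (Filter.Eventually.of_forall fun N => ?_) hdiff
    rw [abs_of_nonneg (ht N).1]
    exact (ht N).2
  have h3 := hHr.add h2
  rw [add_zero] at h3
  exact h3.congr fun N => (h1 N).symm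

theorem tendsto_integral_mul_tentInterpolation (hh : IsConcaveNonneg h) {q : ℝ → ℝ}
    (hq : Integrable q vol01) :
    Filter.Tendsto (fun N => ∫ x, q x * tentInterpolation ((Ioo (0 : ℝ) 1).indicator h) N x ∂vol01)
      Filter.atTop (nhds (∫ x, q x * h x ∂vol01)) := by
  refine tendsto_integral_of_dominated_convergence (fun x => ‖q x‖ * (2 * h (1 / 2)))
    (fun N => hq.aestronglyMeasurable.mul (continuous_tentInterpolation _ N).aestronglyMeasurable)
    (hq.norm.mul_const _) (fun N => ?_) ?_
  · rw [vol01, ae_restrict_iff' measurableSet_Ioo]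
    refine Filter.Eventually.of_forall fun x hx => ?_
    have := hh.tentInterpolation_mem_Icc N hx
    rw [norm_mul]
    refine mul_le_mul_of_nonneg_left ?_ (norm_nonneg _)
    rw [Real.norm_eq_abs, abs_of_nonneg this.1]
    exact this.2
  · rw [vol01, ae_restrict_iff' measurableSet_Ioo]
    exact Filter.Eventually.of_forall fun x hx => (hh.tendsto_tentInterpolation hx).const_mul _

theorem secondDiff_nonneg (hh : IsConcaveNonneg h) {N k : ℕ} (hk : k < N) :
    0 ≤ 2 * (Ioo (0 : ℝ) 1).indicator h (((k + 1 : ℕ) : ℝ) / (N + 1)) -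
      (Ioo (0 : ℝ) 1).indicator h ((k : ℝ) / (N + 1)) -
        (Ioo (0 : ℝ) 1).indicator h (((k + 2 : ℕ) : ℝ) / (N + 1)) := by
  have hN : (0 : ℝ) < (N : ℝ) + 1 := by positivity
  have hmem : ∀ j : ℕ, j ≤ N + 1 → (j : ℝ) / (N + 1) ∈ Icc (0 : ℝ) 1 := fun j hj =>
    ⟨by positivity, (div_le_one hN).2 (by exact_mod_cast hj)⟩
  have h1 := (concaveOn_indicator_Ioo hh.concave hh.nonneg).2 (hmem k (by omega))
    (hmem (k + 2) (by omega)) (by norm_num : (0 : ℝ) ≤ 1 / 2) (by norm_num : (0 : ℝ) ≤ 1 / 2)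
    (by norm_num)
  simp only [smul_eq_mul] at h1
  rw [show 1 / 2 * ((k : ℝ) / (N + 1)) + 1 / 2 * (((k + 2 : ℕ) : ℝ) / (N + 1)) =
    ((k + 1 : ℕ) : ℝ) / (N + 1) by push_cast; field_simp; ring] at h1
  linarith

/-- Linear inequalities that hold for all tents pass to concave functions. -/
theorem le_integral_mul (hh : IsConcaveNonneg h) {q : ℝ → ℝ} (hq : Integrable q vol01)
    {C ε p r s θ : ℝ} (hp : p ∈ Ioo (0 : ℝ) 1) (hr : r ∈ Ioo (0 : ℝ) 1) (hs : s ∈ Ioo (0 : ℝ) 1)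
    (hle : ∀ a ∈ Ioo (0 : ℝ) 1, C * (∫ x, dirichletGreen x a ∂vol01) +
      ε * (dirichletGreen r a - θ * dirichletGreen p a - (1 - θ) * dirichletGreen s a) ≤
        ∫ x, q x * dirichletGreen x a ∂vol01) :
    C * (∫ x, h x ∂vol01) + ε * (h r - θ * h p - (1 - θ) * h s) ≤ ∫ x, q x * h x ∂vol01 := by
  set I : ℕ → ℝ → ℝ := tentInterpolation ((Ioo (0 : ℝ) 1).indicator h) with hI
  set w : ℕ → ℕ → ℝ := fun N k => ((N : ℝ) + 1) *
    (2 * (Ioo (0 : ℝ) 1).indicator h (((k + 1 : ℕ) : ℝ) / (N + 1)) -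
      (Ioo (0 : ℝ) 1).indicator h ((k : ℝ) / (N + 1)) -
        (Ioo (0 : ℝ) 1).indicator h (((k + 2 : ℕ) : ℝ) / (N + 1))) with hw
  have hIw : ∀ N x, I N x =
      ∑ k ∈ Finset.range N, w N k * dirichletGreen x (((k + 1 : ℕ) : ℝ) / (N + 1)) :=
    fun N x => rfl
  have hint : ∀ q : ℝ → ℝ, Integrable q vol01 → ∀ N, ∫ x, q x * I N x ∂vol01 =
      ∑ k ∈ Finset.range N, w N k *
        ∫ x, q x * dirichletGreen x (((k + 1 : ℕ) : ℝ) / (N + 1)) ∂vol01 := by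
    intro q hq N
    simp only [hIw, Finset.mul_sum]
    rw [integral_finsetSum]
    · refine Finset.sum_congr rfl fun k _ => ?_
      rw [← integral_const_mul]
      congr 1
      ext x
      ring
    · intro k _
      obtain ⟨D, hD⟩ := isCompact_Icc.exists_bound_of_continuousOn (s := Icc (0 : ℝ) 1)
        (continuous_const.mul (continuous_dirichletGreen (((k + 1 : ℕ) : ℝ) / (N + 1)))
          : Continuous fun x => w N k * dirichletGreen x _).continuousOn
      refine hq.mul_bdd (c := D) (continuous_const.mul
        (continuous_dirichletGreen _)).aestronglyMeasurable ?_
      rw [vol01, ae_restrict_iff' measurableSet_Ioo]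
      exact Filter.Eventually.of_forall fun x hx => hD x (Ioo_subset_Icc_self hx)
  have h1 := hh.tendsto_integral_mul_tentInterpolation (integrable_const (1 : ℝ))
  simp only [one_mul] at h1
  have h2 := (h1.const_mul C).add ((((hh.tendsto_tentInterpolation hr).sub
    ((hh.tendsto_tentInterpolation hp).const_mul θ)).sub
      ((hh.tendsto_tentInterpolation hs).const_mul (1 - θ))).const_mul ε)
  refine le_of_tendsto_of_tendsto' h2 (hh.tendsto_integral_mul_tentInterpolation hq) fun N => ?_
  have h3 := hint (fun _ => 1) (integrable_const (1 : ℝ)) N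
  simp only [one_mul] at h3
  change C * (∫ x, I N x ∂vol01) + ε * (I N r - θ * I N p - (1 - θ) * I N s) ≤
    ∫ x, q x * I N x ∂vol01
  rw [h3, hint q hq N, hIw N r, hIw N p, hIw N s]
  simp only [Finset.mul_sum]
  rw [← Finset.sum_sub_distrib, ← Finset.sum_sub_distrib, Finset.mul_sum, ← Finset.sum_add_distrib]
  refine Finset.sum_le_sum fun k hk => ?_
  rw [Finset.mem_range] at hk
  have hN : (0 : ℝ) < (N : ℝ) + 1 := by positivity
  -- Concavity enters here: the coefficients of the tents are nonnegative, so the inequalities for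
  -- single tents may be summed.
  have hw0 : 0 ≤ w N k := mul_nonneg hN.le (hh.secondDiff_nonneg hk)
  have h4 := mul_le_mul_of_nonneg_left (hle (((k + 1 : ℕ) : ℝ) / (N + 1))
    ⟨by positivity, (div_lt_one hN).2 (by exact_mod_cast Nat.succ_lt_succ hk)⟩) hw0
  linarith

end IsConcaveNonneg

/-! ### Bounding the eigenvalue; the triangles -/

theorem integral_dirichletGreen {a : ℝ} (ha : a ∈ Icc (0 : ℝ) 1) :
    ∫ x, dirichletGreen x a ∂vol01 = a * (1 - a) / 2 := by
  have hc := continuous_dirichletGreen a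
  rw [integral_vol01, ← intervalIntegral.integral_add_adjacent_intervals (b := a)
    (hc.intervalIntegrable _ _) (hc.intervalIntegrable _ _)]
  have h1 : ∫ x in (0 : ℝ)..a, dirichletGreen x a = ∫ x in (0 : ℝ)..a, (1 - a) * x := by
    refine intervalIntegral.integral_congr fun x hx => ?_
    rw [uIcc_of_le ha.1] at hx
    simp only [dirichletGreen, min_eq_left hx.2]
    ring
  have h2 : ∫ x in a..1, dirichletGreen x a = ∫ x in a..1, (a - a * x) := by
    refine intervalIntegral.integral_congr fun x hx => ?_
    rw [uIcc_of_le ha.2] at hx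
    simp only [dirichletGreen, min_eq_right hx.1]
    ring
  rw [h1, h2, intervalIntegral.integral_sub (by simp) (Continuous.intervalIntegrable (by fun_prop) _ _),
    intervalIntegral.integral_const_mul, intervalIntegral.integral_const_mul, integral_id,
    integral_id, intervalIntegral.integral_const]
  simp only [smul_eq_mul]
  ring

theorem steklovEigenvalue_le {h v v' : ℝ → ℝ} (hh : ∀ x ∈ Ioo (0 : ℝ) 1, 0 ≤ h x) {c : ℝ}
    (hv : IsSobolevH1 v v') (h0 : ∫ x, v x ∂vol01 = 0) (h2 : 0 < ∫ x, v x ^ 2 ∂vol01)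
    (hc : ∫ x, v' x ^ 2 * h x ∂vol01 = c * ∫ x, v x ^ 2 ∂vol01) : steklovEigenvalue h ≤ c := by
  refine csInf_le ⟨0, ?_⟩ ⟨v, v', hv, h0, h2.ne', ?_⟩
  · rintro r ⟨w, w', -, -, -, rfl⟩
    refine div_nonneg (integral_nonneg_of_ae ?_) (integral_nonneg fun x => sq_nonneg _)
    rw [vol01, Filter.EventuallyLE, ae_restrict_iff' measurableSet_Ioo]
    exact Filter.Eventually.of_forall fun x hx => mul_nonneg (sq_nonneg _) (hh x hx)
  · rw [hc, mul_div_cancel_right₀ _ h2.ne']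

theorem le_steklovEigenvalue {h : ℝ → ℝ} {c : ℝ}
    (hle : ∀ V g : ℝ → ℝ, IsSobolevPrimitive V g → ∫ x in (0 : ℝ)..1, V x = 0 →
      c * ∫ x in (0 : ℝ)..1, V x ^ 2 ≤ ∫ x, g x ^ 2 * h x ∂vol01) : c ≤ steklovEigenvalue h := by
  refine le_csInf ?_ ?_
  · refine ⟨_, fun x => x - 1 / 2, fun _ => 1, isSobolevH1_of_hasDerivAt
      (fun x => (hasDerivAt_id' x).sub_const _) continuous_const, ?_, ?_, rfl⟩
    · rw [integral_vol01, intervalIntegral.integral_sub (by simp) (by simp), integral_id]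
      norm_num
    · rw [integral_vol01]
      exact (intervalIntegral.integral_pos zero_lt_one (by fun_prop) (fun x _ => sq_nonneg _)
        ⟨0, ⟨le_rfl, zero_le_one⟩, by norm_num⟩).ne'
  · rintro r ⟨v, v', hv, h0, h2, rfl⟩
    obtain ⟨V, g, hV, hvV, hvg⟩ := hv.exists_isSobolevPrimitive
    have h3 : ∫ x, v x ^ 2 ∂vol01 = ∫ x in (0 : ℝ)..1, V x ^ 2 := by
      rw [← integral_vol01]
      refine integral_congr_ae ?_
      filter_upwards [hvV] with x hx
      rw [hx]
    have h4 : ∫ x, v' x ^ 2 * h x ∂vol01 = ∫ x, g x ^ 2 * h x ∂vol01 := by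
      refine integral_congr_ae ?_
      filter_upwards [hvg] with x hx
      rw [hx]
    have h5 : ∫ x in (0 : ℝ)..1, V x = 0 := by
      rw [← integral_vol01, ← h0]
      exact (integral_congr_ae hvV).symm
    have h6 : 0 < ∫ x, v x ^ 2 ∂vol01 :=
      lt_of_le_of_ne (integral_nonneg fun x => sq_nonneg _) (Ne.symm h2)
    rw [le_div_iff₀ h6, h3, h4]
    exact hle V g hV h5

theorem IsProfile.isConcaveNonneg {h : ℝ → ℝ} (hh : IsProfile h) : IsConcaveNonneg h :=
  ⟨hh.nonneg, hh.concave⟩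

theorem steklovEigenvalue_congr {h k : ℝ → ℝ} (hhk : EqOn h k (Ioo 0 1)) :
    steklovEigenvalue h = steklovEigenvalue k := by
  have : ∀ v' : ℝ → ℝ, ∫ x, v' x ^ 2 * h x ∂vol01 = ∫ x, v' x ^ 2 * k x ∂vol01 := fun v' =>
    setIntegral_congr_fun measurableSet_Ioo fun x hx => by simp only [hhk hx]
  unfold steklovEigenvalue
  simp only [this]

theorem mem_unitProfiles_of_affine {h : ℝ → ℝ} {A B : ℝ} (hAB : ∀ x, h x = A + B * x)
    (hA : 0 ≤ A) (hB : 0 ≤ A + B) (h1 : A + B / 2 = 1) : h ∈ unitProfiles := by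
  obtain rfl : h = fun x => A + B * x := funext hAB
  have hnn : ∀ x ∈ Ioo (0 : ℝ) 1, 0 ≤ A + B * x := fun x hx => by
    nlinarith [mul_nonneg hA (sub_nonneg.2 hx.2.le), mul_nonneg hB hx.1.le]
  refine ⟨⟨?_, hnn, ⟨convex_Ioo 0 1, fun x _ y _ a b _ _ hab => ?_⟩, 1 / 2,
    ⟨by norm_num, by norm_num⟩, ?_⟩, ?_⟩
  · refine MemLp.of_bound (by fun_prop : Continuous fun x : ℝ => A + B * x).aestronglyMeasurable
      (|A| + |B|) ?_
    rw [vol01, ae_restrict_iff' measurableSet_Ioo]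
    refine Filter.Eventually.of_forall fun x hx => (norm_add_le _ _).trans ?_
    rw [norm_mul, Real.norm_eq_abs, Real.norm_eq_abs, Real.norm_eq_abs, abs_of_pos hx.1]
    nlinarith [abs_nonneg B, hx.2]
  · simp only [smul_eq_mul]
    nlinarith
  · show A + B * (1 / 2) ≠ 0
    rw [show A + B * (1 / 2) = 1 by linarith]
    exact one_ne_zero
  · rw [integral_vol01, intervalIntegral.integral_add (by simp)
      (Continuous.intervalIntegrable (by fun_prop) _ _), intervalIntegral.integral_const_mul,
      integral_id, intervalIntegral.integral_const]
    norm_num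
    linarith

theorem triangleZero_mem_unitProfiles : triangleZero ∈ unitProfiles :=
  mem_unitProfiles_of_affine (A := 2) (B := -2) (fun x => by unfold triangleZero; ring)
    (by norm_num) (by norm_num) (by norm_num)

theorem triangleOne_mem_unitProfiles : triangleOne ∈ unitProfiles :=
  mem_unitProfiles_of_affine (A := 0) (B := 2) (fun x => by unfold triangleOne; ring)
    (by norm_num) (by norm_num) (by norm_num)

/-- The test function on `T₁` is `v = f₀(Yx)`. Since `v = (x f₁(Yx))'`, its mean is `f₁(Y) = 0`, and
`2x v' = -2Y x f₁(Yx)` gives `-(2x v')' = 2Y v`. Reflection handles `T₀`. -/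
theorem steklovEigenvalue_triangle_le {Y : ℝ} (hY0 : besselSeries 1 Y = 0) :
    steklovEigenvalue triangleZero ≤ 2 * Y ∧ steklovEigenvalue triangleOne ≤ 2 * Y := by
  set v : ℝ → ℝ := fun x => besselSeries 0 (Y * x) with hv
  set v' : ℝ → ℝ := fun x => -besselSeries 1 (Y * x) * Y with hv'
  have hY : ∀ x : ℝ, HasDerivAt (fun x : ℝ => Y * x) Y x := fun x => by
    simpa using (hasDerivAt_id x).const_mul Y
  have hd : ∀ x, HasDerivAt v (v' x) x := fun x =>
    (hasDerivAt_besselSeries 0 (Y * x)).comp x (hY x)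
  have hd1 : ∀ x, HasDerivAt (fun x => x * besselSeries 1 (Y * x)) (v x) x := fun x => by
    have h1 := (hasDerivAt_besselSeries 1 (Y * x)).comp x (hY x)
    refine ((hasDerivAt_id' x).mul h1).congr_deriv ?_
    have h2 := mul_besselSeries_two (Y * x)
    simp only [hv, Function.comp, one_add_one_eq_two]
    linarith
  have hvc : Continuous v := (continuous_besselSeries 0).comp (by fun_prop)
  have hvc' : Continuous v' :=
    ((continuous_besselSeries 1).comp (by fun_prop : Continuous fun x : ℝ => Y * x)).neg.mul
      continuous_const
  have h0 : ∫ x in (0 : ℝ)..1, v x = 0 := by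
    rw [intervalIntegral.integral_eq_sub_of_hasDerivAt (fun x _ => hd1 x)
      (hvc.intervalIntegrable _ _)]
    simp [hY0]
  have hsq : 0 < ∫ x in (0 : ℝ)..1, v x ^ 2 := by
    refine intervalIntegral.integral_pos zero_lt_one (hvc.pow 2).continuousOn
      (fun x _ => sq_nonneg _) ⟨0, ⟨le_rfl, zero_le_one⟩, pow_pos ?_ 2⟩
    simp only [hv, mul_zero]
    exact besselSeries_zero_pos ⟨le_rfl, zero_le_one⟩
  have hE : ∫ x in (0 : ℝ)..1, v' x ^ 2 * (2 * x) = 2 * Y * ∫ x in (0 : ℝ)..1, v x ^ 2 := by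
    -- The function `v · 2x v'`, which vanishes at both ends.
    have h1 : ∀ x, HasDerivAt (fun x => -2 * Y * (v x * (x * besselSeries 1 (Y * x))))
        (v' x ^ 2 * (2 * x) - 2 * Y * v x ^ 2) x := fun x => by
      refine (((hd x).mul (hd1 x)).const_mul (-2 * Y)).congr_deriv ?_
      simp only [hv']
      ring
    have hi1 : IntervalIntegrable (fun x => v' x ^ 2 * (2 * x)) volume 0 1 :=
      Continuous.intervalIntegrable (by fun_prop) _ _
    have hi2 : IntervalIntegrable (fun x => 2 * Y * v x ^ 2) volume 0 1 :=
      Continuous.intervalIntegrable (by fun_prop) _ _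
    have h2 := intervalIntegral.integral_eq_sub_of_hasDerivAt (a := 0) (b := 1)
      (fun x _ => h1 x) (hi1.sub hi2)
    rw [intervalIntegral.integral_sub hi1 hi2, intervalIntegral.integral_const_mul] at h2
    simp only [mul_one, hY0, mul_zero, zero_mul, sub_self] at h2
    linarith
  constructor
  · refine steklovEigenvalue_le (v := fun x => v (1 - x)) (v' := fun x => -v' (1 - x))
      triangleZero_mem_unitProfiles.1.nonneg (isSobolevH1_of_hasDerivAt (fun x => ?_)
        (hvc'.comp (by fun_prop)).neg) ?_ ?_ ?_
    · exact ((hd (1 - x)).comp x ((hasDerivAt_id' x).const_sub 1)).congr_deriv (by ring)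
    · rw [integral_vol01, intervalIntegral.integral_comp_sub_left]
      simpa using h0
    · rw [integral_vol01, intervalIntegral.integral_comp_sub_left (fun x => v x ^ 2)]
      simpa using hsq
    · have h3 : ∀ x, (-v' (1 - x)) ^ 2 * triangleZero x =
          (fun x => v' x ^ 2 * (2 * x)) (1 - x) := fun x => by
        simp only [triangleZero, neg_sq]
      simp only [h3]
      rw [integral_vol01, integral_vol01, intervalIntegral.integral_comp_sub_left
        (fun x => v' x ^ 2 * (2 * x)), intervalIntegral.integral_comp_sub_left (fun x => v x ^ 2)]
      simpa using hE
  · refine steklovEigenvalue_le triangleOne_mem_unitProfiles.1.nonneg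
      (isSobolevH1_of_hasDerivAt hd hvc') ?_ ?_ ?_
    · rw [integral_vol01, h0]
    · rw [integral_vol01]
      exact hsq
    · rw [integral_vol01, integral_vol01]
      exact hE

/-! ### Lower bound and uniqueness -/

section LowerBound

variable {Y : ℝ}

theorem besselSeries_kink_pos (hY : 0 < Y) (hY4 : Y < 4) (hY0 : besselSeries 1 Y = 0)
    (hpos : ∀ y ∈ Ico 0 Y, 0 < besselSeries 1 y) {a : ℝ} (ha : a ∈ Ioo (0 : ℝ) 1) :
    0 < besselSeries 0 (Y * a ^ 2) * ((1 - a) * besselSeries 1 (Y * (1 - a) ^ 2)) +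
      besselSeries 0 (Y * (1 - a) ^ 2) * (a * besselSeries 1 (Y * a ^ 2)) := by
  have hs : 0 < √Y := Real.sqrt_pos.2 hY
  have hsq : √Y ^ 2 = Y := Real.sq_sqrt hY.le
  have h1 := besselSeries_addition_pos hY4 hY0 hpos (mul_pos hs ha.1)
    (mul_pos hs (sub_pos.2 ha.2)) (by rw [← mul_add, add_sub_cancel, mul_one, hsq])
  rw [mul_pow, mul_pow, hsq] at h1
  refine (mul_pos_iff_of_pos_left hs).1 (h1.trans_eq ?_)
  ring

theorem IsSobolevPrimitive.integrable_sq_vol01 {V g : ℝ → ℝ} (h : IsSobolevPrimitive V g) :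
    Integrable (fun x => g x ^ 2) vol01 :=
  h.integrable_sq.restrict

theorem IsSobolevPrimitive.le_integral_dirichletGreen_first_zero {V g : ℝ → ℝ}
    (h : IsSobolevPrimitive V g) (h0 : ∫ x in (0 : ℝ)..1, V x = 0) (hY : 0 < Y) (hY4 : Y < 4)
    (hY0 : besselSeries 1 Y = 0) (hpos : ∀ y ∈ Ico 0 Y, 0 < besselSeries 1 y) {a : ℝ}
    (ha : a ∈ Ioo (0 : ℝ) 1) :
    Y * (a * (1 - a)) * ∫ x in (0 : ℝ)..1, V x ^ 2 ≤ ∫ x, g x ^ 2 * dirichletGreen x a ∂vol01 := by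
  rw [integral_vol01]
  have hlt : ∀ b ∈ Ioo (0 : ℝ) 1, Y * b ^ 2 < Y := fun b hb => by
    have : b ^ 2 < 1 := by nlinarith [hb.1, hb.2]
    nlinarith
  exact h.le_integral_dirichletGreen h0 hY ha
    (fun y hy => hpos y ⟨hy.1, hy.2.trans_lt (hlt a ha)⟩)
    (fun y hy => hpos y ⟨hy.1, hy.2.trans_lt
      (hlt (1 - a) ⟨by linarith [ha.2], by linarith [ha.1]⟩)⟩)
    (besselSeries_kink_pos hY hY4 hY0 hpos ha).le

/-- Tents with peak in a compact subinterval of `(0,1)` satisfy a uniformly better inequality. -/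
theorem exists_uniform_tent_constant (hY : 0 < Y) (hY4 : Y < 4) (hY0 : besselSeries 1 Y = 0)
    (hpos : ∀ y ∈ Ico 0 Y, 0 < besselSeries 1 y) {p s : ℝ} (hp : 0 < p) (hs : s < 1) :
    ∃ τ, Y < τ ∧ ∀ V g : ℝ → ℝ, IsSobolevPrimitive V g → ∫ x in (0 : ℝ)..1, V x = 0 →
      ∀ a ∈ Icc p s, τ * (a * (1 - a)) * ∫ x in (0 : ℝ)..1, V x ^ 2 ≤
        ∫ x, g x ^ 2 * dirichletGreen x a ∂vol01 := by
  have hc0 := continuous_besselSeries 0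
  have hc1 := continuous_besselSeries 1
  have hev : ∀ᶠ τ in nhds Y, ∀ a ∈ Icc p s, (τ * a ^ 2 < Y ∧ τ * (1 - a) ^ 2 < Y) ∧
      0 < besselSeries 0 (τ * a ^ 2) * ((1 - a) * besselSeries 1 (τ * (1 - a) ^ 2)) +
        besselSeries 0 (τ * (1 - a) ^ 2) * (a * besselSeries 1 (τ * a ^ 2)) := by
    refine isCompact_Icc.eventually_forall_of_forall_eventually fun a ha => ?_
    have ha' : a ∈ Ioo (0 : ℝ) 1 := ⟨hp.trans_le ha.1, ha.2.trans_lt hs⟩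
    have hlt : ∀ b ∈ Ioo (0 : ℝ) 1, Y * b ^ 2 < Y := fun b hb => by
      have : b ^ 2 < 1 := by nlinarith [hb.1, hb.2]
      nlinarith
    have e1 : ∀ᶠ z : ℝ × ℝ in nhds (Y, a), z.1 * z.2 ^ 2 < Y :=
      ContinuousAt.eventually_lt (by fun_prop) continuousAt_const (hlt a ha')
    have e2 : ∀ᶠ z : ℝ × ℝ in nhds (Y, a), z.1 * (1 - z.2) ^ 2 < Y :=
      ContinuousAt.eventually_lt (by fun_prop) continuousAt_const
        (hlt (1 - a) ⟨by linarith [ha'.2], by linarith [ha'.1]⟩)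
    have e3 : ∀ᶠ z : ℝ × ℝ in nhds (Y, a),
        0 < besselSeries 0 (z.1 * z.2 ^ 2) * ((1 - z.2) * besselSeries 1 (z.1 * (1 - z.2) ^ 2)) +
          besselSeries 0 (z.1 * (1 - z.2) ^ 2) * (z.2 * besselSeries 1 (z.1 * z.2 ^ 2)) :=
      ContinuousAt.eventually_lt continuousAt_const
        (Continuous.continuousAt (by fun_prop)) (besselSeries_kink_pos hY hY4 hY0 hpos ha')
    exact (e1.and e2).and e3
  obtain ⟨τ, hτ, hτY⟩ := ((hev.filter_mono nhdsWithin_le_nhds).and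
    (self_mem_nhdsWithin (a := Y) (s := Ioi Y))).exists
  refine ⟨τ, hτY, fun V g h h0 a ha => ?_⟩
  obtain ⟨⟨h1, h2⟩, h3⟩ := hτ a ha
  rw [integral_vol01]
  exact h.le_integral_dirichletGreen h0 (hY.trans hτY) ⟨hp.trans_le ha.1, ha.2.trans_lt hs⟩
    (fun y hy => hpos y ⟨hy.1, hy.2.trans_lt h1⟩) (fun y hy => hpos y ⟨hy.1, hy.2.trans_lt h2⟩)
    h3.le

theorem IsConcaveNonneg.le_integral_sq_mul {h V g : ℝ → ℝ} (hh : IsConcaveNonneg h)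
    (h1 : ∫ x, h x ∂vol01 = 1) (hV : IsSobolevPrimitive V g) (h0 : ∫ x in (0 : ℝ)..1, V x = 0)
    (hY : 0 < Y) (hY4 : Y < 4) (hY0 : besselSeries 1 Y = 0)
    (hpos : ∀ y ∈ Ico 0 Y, 0 < besselSeries 1 y) :
    2 * Y * ∫ x in (0 : ℝ)..1, V x ^ 2 ≤ ∫ x, g x ^ 2 * h x ∂vol01 := by
  have hmid : (1 / 2 : ℝ) ∈ Ioo (0 : ℝ) 1 := ⟨by norm_num, by norm_num⟩
  -- With `ε = 0` the chord term drops out, so the three points are arbitrary.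
  have := hh.le_integral_mul hV.integrable_sq_vol01 (C := 2 * Y * ∫ x in (0 : ℝ)..1, V x ^ 2)
    (ε := 0) (θ := 0) hmid hmid hmid fun a ha => by
      rw [integral_dirichletGreen (Ioo_subset_Icc_self ha)]
      have := hV.le_integral_dirichletGreen_first_zero h0 hY hY4 hY0 hpos ha
      linarith
  rw [h1] at this
  linarith

theorem two_mul_le_steklovEigenvalue {h : ℝ → ℝ} (hh : h ∈ unitProfiles) (hY : 0 < Y)
    (hY4 : Y < 4) (hY0 : besselSeries 1 Y = 0) (hpos : ∀ y ∈ Ico 0 Y, 0 < besselSeries 1 y) :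
    2 * Y ≤ steklovEigenvalue h :=
  le_steklovEigenvalue fun _ _ hV h0 =>
    hh.1.isConcaveNonneg.le_integral_sq_mul hh.2 hV h0 hY hY4 hY0 hpos

/-- A tent is affine away from its peak, so its gap above the chord over `[p, s]` is zero unless the
peak lies there. The gap of `h` thus detects tents with peak in `[p, s]`. -/
theorem dirichletGreen_gap_le {p r s θ a : ℝ} (hp : 0 < p) (hs : s < 1) (hpr : p < r) (hrs : r < s)
    (hθ : θ ∈ Ioo (0 : ℝ) 1) (hr : r = θ * p + (1 - θ) * s) :
    dirichletGreen r a - θ * dirichletGreen p a - (1 - θ) * dirichletGreen s a ≤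
      if a ∈ Icc p s then 1 else 0 := by
  have e : dirichletGreen r a - θ * dirichletGreen p a - (1 - θ) * dirichletGreen s a =
      min r a - θ * min p a - (1 - θ) * min s a := by
    unfold dirichletGreen
    rw [hr]
    ring
  rw [e]
  have hθ0 := hθ.1
  have hθ1 : 0 < 1 - θ := sub_pos.2 hθ.2
  split_ifs with ha
  · rw [min_eq_left ha.1, min_eq_right ha.2]
    have h1 : min r a ≤ r := min_le_left _ _
    have h2 := mul_pos hθ0 hp
    have h3 := mul_pos hθ1 (hp.trans_le ha.1)
    linarith
  · rw [mem_Icc, not_and_or, not_le, not_le] at ha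
    rcases ha with ha | ha
    · rw [min_eq_right ha.le, min_eq_right (ha.le.trans hpr.le),
        min_eq_right (ha.le.trans (hpr.trans hrs).le)]
      linarith
    · rw [min_eq_left ha.le, min_eq_left (hrs.trans ha).le,
        min_eq_left (hpr.trans (hrs.trans ha)).le]
      linarith

theorem two_mul_lt_steklovEigenvalue_of_gap {h : ℝ → ℝ} (hh : h ∈ unitProfiles) (hY : 0 < Y)
    (hY4 : Y < 4) (hY0 : besselSeries 1 Y = 0) (hpos : ∀ y ∈ Ico 0 Y, 0 < besselSeries 1 y)
    {p r s θ : ℝ} (hp : 0 < p) (hs : s < 1) (hpr : p < r) (hrs : r < s)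
    (hθ : θ ∈ Ioo (0 : ℝ) 1) (hr : r = θ * p + (1 - θ) * s)
    (hgap : θ * h p + (1 - θ) * h s < h r) : 2 * Y < steklovEigenvalue h := by
  obtain ⟨τ, hτ, htent⟩ := exists_uniform_tent_constant hY hY4 hY0 hpos hp hs
  have hs1 : 0 < 1 - s := sub_pos.2 hs
  -- For peaks `a` in `[p, s]` one has `a(1-a) ≥ p(1-s)`, so replacing `Y` by `τ` gains at least
  -- this multiple of `∫ V²`, while the tent's gap is at most 1.
  have hε : 0 < (τ - Y) * (p * (1 - s)) := mul_pos (sub_pos.2 hτ) (mul_pos hp hs1)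
  refine lt_of_lt_of_le (lt_add_of_pos_right _ (mul_pos hε
    (show 0 < h r - θ * h p - (1 - θ) * h s by linarith))) (le_steklovEigenvalue fun V g hV h0 => ?_)
  have hS : 0 ≤ ∫ x in (0 : ℝ)..1, V x ^ 2 :=
    intervalIntegral.integral_nonneg zero_le_one fun x _ => sq_nonneg _
  set S := ∫ x in (0 : ℝ)..1, V x ^ 2 with hSdef
  have key := hh.1.isConcaveNonneg.le_integral_mul hV.integrable_sq_vol01 (C := 2 * Y * S)
    (ε := (τ - Y) * (p * (1 - s)) * S) (p := p) (r := r) (s := s) (θ := θ)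
    ⟨hp, by linarith⟩ ⟨by linarith, by linarith⟩ ⟨by linarith, hs⟩ fun a ha => by
      rw [integral_dirichletGreen (Ioo_subset_Icc_self ha)]
      have h1 := mul_le_mul_of_nonneg_left
        (dirichletGreen_gap_le (a := a) hp hs hpr hrs hθ hr) (mul_nonneg hε.le hS)
      split_ifs at h1 with hmem
      · have h2 := htent V g hV h0 a hmem
        have h3 : p * (1 - s) ≤ a * (1 - a) :=
          mul_le_mul hmem.1 (by linarith [hmem.2]) hs1.le ha.1.le
        have h4 := mul_le_mul_of_nonneg_left h3 (mul_nonneg (sub_pos.2 hτ).le hS)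
        linarith
      · have h2 := hV.le_integral_dirichletGreen_first_zero h0 hY hY4 hY0 hpos ha
        linarith
  rw [hh.2] at key
  linarith

/-- Since `T₀ + T₁ = 2`, one can split off the constant `2m` with `m = min α β`. It contributes
`16m` by the Poincaré inequality, the rest `2Y(1 - 2m)`, and the excess over `2Y` is `m(16 - 4Y) >
0`. -/
theorem two_mul_lt_steklovEigenvalue_of_affine {h : ℝ → ℝ} {α β : ℝ} (hα : 0 < α) (hβ : 0 < β)
    (hαβ : α + β = 1)
    (hh : ∀ x ∈ Ioo (0 : ℝ) 1, h x = α * triangleZero x + β * triangleOne x) (hY : 0 < Y)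
    (hY4 : Y < 4) (hY0 : besselSeries 1 Y = 0) (hpos : ∀ y ∈ Ico 0 Y, 0 < besselSeries 1 y) :
    2 * Y < steklovEigenvalue h := by
  set m := min α β with hm
  have hm0 : 0 < m := lt_min hα hβ
  have hmα : 0 ≤ α - m := sub_nonneg.2 (min_le_left _ _)
  have hmβ : 0 ≤ β - m := sub_nonneg.2 (min_le_right _ _)
  refine lt_of_lt_of_le (lt_add_of_pos_right _ (mul_pos hm0 (show 0 < 16 - 4 * Y by linarith)))
    (le_steklovEigenvalue fun V g hV h0 => ?_)
  have h1 := triangleZero_mem_unitProfiles.1.isConcaveNonneg.le_integral_sq_mul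
    triangleZero_mem_unitProfiles.2 hV h0 hY hY4 hY0 hpos
  have h2 := triangleOne_mem_unitProfiles.1.isConcaveNonneg.le_integral_sq_mul
    triangleOne_mem_unitProfiles.2 hV h0 hY hY4 hY0 hpos
  have h3 := hV.eight_mul_integral_sq_le h0
  have hi : ∀ k : ℝ → ℝ, Continuous k →
      IntervalIntegrable (fun x => g x ^ 2 * k x) volume 0 1 := fun k hk =>
    hV.intervalIntegrable_sq_mul hk 0 1
  have hT0 : Continuous triangleZero := by unfold triangleZero; fun_prop
  have hT1 : Continuous triangleOne := by unfold triangleOne; fun_prop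
  have h4 : ∫ x, g x ^ 2 * h x ∂vol01 = ∫ x, (2 * m * (g x ^ 2) +
      ((α - m) * (g x ^ 2 * triangleZero x) + (β - m) * (g x ^ 2 * triangleOne x))) ∂vol01 := by
    refine setIntegral_congr_fun measurableSet_Ioo fun x hx => ?_
    simp only [hh x hx, triangleZero, triangleOne]
    ring
  rw [h4, integral_vol01, intervalIntegral.integral_add
    (hV.integrable_sq.intervalIntegrable.const_mul _)
    (((hi _ hT0).const_mul _).add ((hi _ hT1).const_mul _)), intervalIntegral.integral_add
    ((hi _ hT0).const_mul _) ((hi _ hT1).const_mul _), intervalIntegral.integral_const_mul,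
    intervalIntegral.integral_const_mul, intervalIntegral.integral_const_mul]
  rw [integral_vol01] at h1 h2
  have h5 := mul_le_mul_of_nonneg_left h1 hmα
  have h6 := mul_le_mul_of_nonneg_left h2 hmβ
  have h7 := mul_le_mul_of_nonneg_left h3 (show 0 ≤ 2 * m by linarith)
  obtain rfl : β = 1 - α := by linarith
  linarith

/-- A concave function on `(0,1)` that is never strictly above its chords is affine. -/
theorem exists_affine_of_no_gap {h : ℝ → ℝ} (hc : ConcaveOn ℝ (Ioo (0 : ℝ) 1) h)
    (hno : ∀ p r s θ : ℝ, 0 < p → s < 1 → p < r → r < s → θ ∈ Ioo (0 : ℝ) 1 →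
      r = θ * p + (1 - θ) * s → ¬ θ * h p + (1 - θ) * h s < h r) :
    ∃ A B : ℝ, ∀ x ∈ Ioo (0 : ℝ) 1, h x = A + B * x := by
  have heq : ∀ p r s : ℝ, 0 < p → s < 1 → p < r → r < s →
      (s - r) * h p + (r - p) * h s = (s - p) * h r := by
    intro p r s hp hs hpr hrs
    have hsp : 0 < s - p := by linarith
    have hθ : (s - r) / (s - p) ∈ Ioo (0 : ℝ) 1 :=
      ⟨div_pos (by linarith) hsp, (div_lt_one hsp).2 (by linarith)⟩
    have hr : r = (s - r) / (s - p) * p + (1 - (s - r) / (s - p)) * s := by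
      field_simp
      ring
    have h1 := not_lt.1 (hno p r s _ hp hs hpr hrs hθ hr)
    have h2 := hc.2 (x := p) ⟨hp, by linarith⟩ (y := s) ⟨by linarith, hs⟩ hθ.1.le
      (sub_nonneg.2 hθ.2.le) (add_sub_cancel _ _)
    simp only [smul_eq_mul] at h2
    rw [← hr] at h2
    have h3 := le_antisymm h1 h2
    rw [h3]
    field_simp
    ring
  -- The line through the graph at `1/3` and `2/3`; any third point is collinear with these two by
  -- `heq`.
  refine ⟨2 * h (1 / 3) - h (2 / 3), 3 * (h (2 / 3) - h (1 / 3)), fun x hx => ?_⟩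
  rcases lt_trichotomy x (1 / 3) with h1 | rfl | h1
  · have := heq x (1 / 3) (2 / 3) hx.1 (by norm_num) h1 (by norm_num)
    linarith
  · ring
  rcases lt_trichotomy x (2 / 3) with h2 | rfl | h2
  · have := heq (1 / 3) x (2 / 3) (by norm_num) (by norm_num) h1 h2
    linarith
  · ring
  · have := heq (1 / 3) (2 / 3) x (by norm_num) hx.2 (by norm_num) h2
    linarith

theorem nonneg_of_affine_nonneg {A B : ℝ} (h : ∀ x ∈ Ioo (0 : ℝ) 1, 0 ≤ A + B * x) :
    0 ≤ A ∧ 0 ≤ A + B := by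
  have hc : Continuous fun x : ℝ => A + B * x := by fun_prop
  have hcl : ∀ x ∈ Icc (0 : ℝ) 1, 0 ≤ A + B * x := fun x hx => by
    rw [← closure_Ioo zero_ne_one] at hx
    exact closure_minimal h (isClosed_le continuous_const hc) hx
  have h0 := hcl 0 ⟨le_rfl, zero_le_one⟩
  have h1 := hcl 1 ⟨zero_le_one, le_rfl⟩
  constructor <;> linarith

theorem eqOn_triangle_or_two_mul_lt_steklovEigenvalue {h : ℝ → ℝ} (hh : h ∈ unitProfiles)
    (hY : 0 < Y) (hY4 : Y < 4) (hY0 : besselSeries 1 Y = 0)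
    (hpos : ∀ y ∈ Ico 0 Y, 0 < besselSeries 1 y) :
    (EqOn h triangleZero (Ioo 0 1) ∨ EqOn h triangleOne (Ioo 0 1)) ∨
      2 * Y < steklovEigenvalue h := by
  refine or_iff_not_imp_right.2 fun hnot => ?_
  obtain ⟨A, B, hAB⟩ := exists_affine_of_no_gap hh.1.concave
    fun p r s θ hp hs hpr hrs hθ hr hgap => hnot
      (two_mul_lt_steklovEigenvalue_of_gap hh hY hY4 hY0 hpos hp hs hpr hrs hθ hr hgap)
  obtain ⟨hA, hAB1⟩ := nonneg_of_affine_nonneg fun x hx => (hh.1.nonneg x hx).trans_eq (hAB x hx)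
  have hint : A + B / 2 = 1 := by
    rw [← hh.2, vol01, setIntegral_congr_fun measurableSet_Ioo hAB, ← vol01, integral_vol01,
      intervalIntegral.integral_add (by simp) (Continuous.intervalIntegrable (by fun_prop) _ _),
      intervalIntegral.integral_const_mul, integral_id, intervalIntegral.integral_const]
    norm_num
    ring
  rcases hA.eq_or_lt with rfl | hA
  · refine Or.inr fun x hx => ?_
    rw [hAB x hx, triangleOne]
    linear_combination 2 * x * hint
  rcases hAB1.eq_or_lt with hB | hB
  · refine Or.inl fun x hx => ?_
    rw [hAB x hx, triangleZero]
    linear_combination (2 - 2 * x) * hint + (1 - 2 * x) * hB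
  exact absurd (two_mul_lt_steklovEigenvalue_of_affine (half_pos hA) (half_pos hB) (by linarith)
    (fun x hx => by rw [hAB x hx, triangleZero, triangleOne]; ring) hY hY4 hY0 hpos) hnot

end LowerBound

theorem theorem1p1 :
    triangleZero ∈ unitProfiles ∧ triangleOne ∈ unitProfiles ∧
    (∀ h ∈ unitProfiles,
      IsMinOn steklovEigenvalue unitProfiles h ↔
        (EqOn h triangleZero (Ioo 0 1) ∨ EqOn h triangleOne (Ioo 0 1))) ∧
    ∃ j : ℝ, IsFirstZeroBesselDeriv j ∧
      steklovEigenvalue triangleZero = j ^ 2 / 2 ∧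
      steklovEigenvalue triangleOne = j ^ 2 / 2 ∧
      IsLeast (steklovEigenvalue '' unitProfiles) (j ^ 2 / 2) := by
  obtain ⟨Y, hY1, hY4, hY0, hpos⟩ := exists_first_zero_besselSeries_one
  have hY : 0 < Y := one_pos.trans hY1
  have hlow : ∀ h ∈ unitProfiles, 2 * Y ≤ steklovEigenvalue h := fun h hh =>
    two_mul_le_steklovEigenvalue hh hY hY4 hY0 hpos
  have hzero : steklovEigenvalue triangleZero = 2 * Y :=
    le_antisymm (steklovEigenvalue_triangle_le hY0).1 (hlow _ triangleZero_mem_unitProfiles)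
  have hone : steklovEigenvalue triangleOne = 2 * Y :=
    le_antisymm (steklovEigenvalue_triangle_le hY0).2 (hlow _ triangleOne_mem_unitProfiles)
  have hj : (2 * √Y) ^ 2 / 2 = 2 * Y := by
    rw [mul_pow, Real.sq_sqrt hY.le]
    ring
  refine ⟨triangleZero_mem_unitProfiles, triangleOne_mem_unitProfiles, fun h hh => ⟨fun hmin => ?_,
    fun heq k hk => ?_⟩, 2 * √Y, isFirstZeroBesselDeriv_of_first_zero hY hY0 hpos,
    hzero.trans hj.symm, hone.trans hj.symm, ?_⟩
  · refine (eqOn_triangle_or_two_mul_lt_steklovEigenvalue hh hY hY4 hY0 hpos).resolve_right ?_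
    rw [not_lt, ← hzero]
    exact hmin triangleZero_mem_unitProfiles
  · have h2 : steklovEigenvalue h = 2 * Y := by
      rcases heq with heq | heq
      · rw [steklovEigenvalue_congr heq, hzero]
      · rw [steklovEigenvalue_congr heq, hone]
    exact h2.trans_le (hlow k hk)
  · rw [hj]
    refine ⟨⟨triangleZero, triangleZero_mem_unitProfiles, hzero⟩, ?_⟩
    rintro _ ⟨h, hh, rfl⟩
    exact hlow h hh
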